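/- Let $d\ge 1$, let $X$ be one of the complex sequence spaces $\ell_p(\mathbb N)$, $1\le p<\infty$, or $c_0(\mathbb N)$, with its norm topology, and let $\alpha\in(0,1/d)$. For a sequence $w=(w_n)_{n\ge1}$ of positive numbers, let $B_w(x_0,x_1,x_2,\dots)=(w_1x_1,w_2x_2,\dots)$ be the weighted backward shift; $w$ is admissible if $B_w$ maps $X$ into $X$ and is continuous. Products of sequences are coordinatewise, and $X^d$ carries the product topology and the componentwise product. A vector $x$ is hypercyclic for an operator $T$ if $\{T^nx:n\ge1\}$ is dense. A family of operators $(T_\lambda)_{\lambda\in\Lambda}$ on $X^d$ admits a common hypercyclic algebra if there is a subalgebra $A\neq\{0\}$ of $X^d$ all of whose non-zero elements are hypercyclic for every $T_\lambda$, $\lambda\in\Lambda$. Let $I\subset(0,+\infty)$ be $\sigma$-compact and let $(w(a))_{a\in I}$ be a continuous family of weights: each $w(a)$ is an admissible sequence of positive weights, each $a\mapsto w_n(a)$ is continuous on $I$, and $(a,x)\mapsto B_{w(a)}x$ is continuous on $I\times X$. Assume that for every compact $I_0\subset I$ there are $D_1,D_2,D_3>0$ and $N\ge0$ such that, for all $n\ge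 N$, 1. $a\mapsto\sum_{i=1}^n\log w_i(a)$ is $D_1n^\alpha$-Lipschitz on $I_0$; 2. $w_1(a)\cdots w_n(a)\ge D_2\exp(D_3n^\alpha)$ for all $a\in I_0$. Then the family $\big(B_{w(\lambda_1)}\times\cdots\times B_{w(\lambda_d)}\big)_{\lambda\in I^d}$ admits a common hypercyclic algebra in $X^d$ for the coordinatewise product. In particular, for $w_n(a)=1+\dfrac{a}{n^{1-\alpha}}$, the family $\big(B_{w(\lambda_1)}\times\cdots\times B_{w(\lambda_d)}\big)_{\lambda\in(0,+\infty)^d}$ admits a common hypercyclic algebra in $X^d$ for the coordinatewise product. -/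

import Mathlib

open scoped ENNReal ZeroAtInfty

noncomputable section

/-! ### The coordinatewise product on `ℓ_p` -/

theorem ellp_memℓp_mul {p : ℝ≥0∞} (x y : lp (fun _ : ℕ => ℂ) p) :
    Memℓp (fun n => x n * y n) p := by
  have hy : Memℓp (fun n => y n) ∞ := (lp.memℓp y).of_exponent_ge le_top
  obtain ⟨C, hC⟩ := memℓp_infty_iff.1 hy
  have hC' : ∀ n, ‖y n‖ ≤ C := fun n => hC ⟨n, rfl⟩
  have hx : Memℓp (fun n => (C : ℂ) * x n) p := (lp.memℓp x).const_mul (C : ℂ)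
  refine hx.mono' fun n => ?_
  have hC0 : 0 ≤ C := (norm_nonneg _).trans (hC' 0)
  rw [norm_mul, norm_mul, Complex.norm_real, Real.norm_of_nonneg hC0, mul_comm]
  exact mul_le_mul_of_nonneg_right (hC' n) (norm_nonneg _)

/-- The coordinatewise product makes `ℓ_p(ℕ)`, `1 ≤ p`, a commutative (non-unital) ring. -/
instance ellpNonUnitalCommRing (p : ℝ≥0∞) [Fact (1 ≤ p)] :
    NonUnitalCommRing (lp (fun _ : ℕ => ℂ) p) :=
  { (inferInstance : AddCommGroup (lp (fun _ : ℕ => ℂ) p)) with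
    mul := fun x y => ⟨fun n => x n * y n, ellp_memℓp_mul x y⟩
    left_distrib := fun x y z => lp.ext (funext fun n => mul_add (x n) (y n) (z n))
    right_distrib := fun x y z => lp.ext (funext fun n => add_mul (x n) (y n) (z n))
    zero_mul := fun x => lp.ext (funext fun n => zero_mul (x n))
    mul_zero := fun x => lp.ext (funext fun n => mul_zero (x n))
    mul_assoc := fun x y z => lp.ext (funext fun n => mul_assoc (x n) (y n) (z n))
    mul_comm := fun x y => lp.ext (funext fun n => mul_comm (x n) (y n)) }

instance ellpIsScalarTower (p : ℝ≥0∞) [Fact (1 ≤ p)] :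
    IsScalarTower ℂ (lp (fun _ : ℕ => ℂ) p) (lp (fun _ : ℕ => ℂ) p) :=
  ⟨fun c x y => lp.ext (funext fun n => mul_assoc c (x n) (y n))⟩

instance ellpSMulCommClass (p : ℝ≥0∞) [Fact (1 ≤ p)] :
    SMulCommClass ℂ (lp (fun _ : ℕ => ℂ) p) (lp (fun _ : ℕ => ℂ) p) :=
  ⟨fun c x y => lp.ext (funext fun n => mul_left_comm c (x n) (y n))⟩

/-! ### Sequence spaces and weighted backward shifts -/

/-- A complex sequence space: a complex vector space `X` identified with a space of sequences
by an injective linear coordinate map `X → ℂ^ℕ`, in such a way that the product of `X` is the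
coordinatewise product of sequences. -/
class SequenceAlgebra (X : Type*) [NonUnitalCommRing X] [Module ℂ X] where
  /-- The sequence of coordinates of a vector. -/
  coord : X →ₗ[ℂ] (ℕ → ℂ)
  coord_injective : Function.Injective coord
  coord_mul : ∀ x y : X, ∀ n : ℕ, coord (x * y) n = coord x n * coord y n

instance ellpSequenceAlgebra (p : ℝ≥0∞) [Fact (1 ≤ p)] :
    SequenceAlgebra (lp (fun _ : ℕ => ℂ) p) where
  coord :=
    { toFun := fun x n => x n
      map_add' := fun _ _ => rfl
      map_smul' := fun _ _ => rfl }
  coord_injective := fun _ _ h => lp.ext h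
  coord_mul := fun _ _ _ => rfl

/-- `C₀(ℕ, ℂ)` is `c₀(ℕ)`, since `ℕ` is discrete. -/
instance cZeroSequenceAlgebra : SequenceAlgebra C₀(ℕ, ℂ) where
  coord :=
    { toFun := fun x n => x n
      map_add' := fun _ _ => rfl
      map_smul' := fun _ _ => rfl }
  coord_injective := DFunLike.coe_injective
  coord_mul := fun _ _ _ => rfl

section Shifts

variable (X : Type*) [NonUnitalCommRing X] [Module ℂ X] [TopologicalSpace X] [SequenceAlgebra X]

/-- `T` is the weighted backward shift `B_w (x₀, x₁, x₂, …) = (w₁ x₁, w₂ x₂, …)` on `X`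
(the value `w 0` plays no role). -/
def IsBackwardShift (w : ℕ → ℝ) (T : X →L[ℂ] X) : Prop :=
  ∀ (x : X) (n : ℕ), SequenceAlgebra.coord (T x) n =
    (w (n + 1) : ℂ) * SequenceAlgebra.coord x (n + 1)

/-- The weight sequence `w` is admissible for `X`: the weights `w₁, w₂, …` are positive, and
`B_w` maps `X` into `X` and is continuous. -/
def IsAdmissible (w : ℕ → ℝ) : Prop :=
  (∀ n : ℕ, 1 ≤ n → 0 < w n) ∧ ∃ T : X →L[ℂ] X, IsBackwardShift X w T

open Classical in
/-- The weighted backward shift `B_w` on `X` (by convention `0` if `w` is not admissible). -/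
def backwardShift (w : ℕ → ℝ) : X →L[ℂ] X :=
  if h : IsAdmissible X w then h.2.choose else 0

variable {X} in
theorem coord_backwardShift {w : ℕ → ℝ} (h : IsAdmissible X w) (x : X) (n : ℕ) :
    SequenceAlgebra.coord (backwardShift X w x) n =
      (w (n + 1) : ℂ) * SequenceAlgebra.coord x (n + 1) := by
  rw [backwardShift, dif_pos h]
  exact h.2.choose_spec x n

/-- `(w(a))_{a ∈ I}` is a continuous family of weights for `X`: every `w(a)` is an admissible
weight sequence, every `w_n` is continuous on `I`, and `(a, x) ↦ B_{w(a)} x` is continuous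
on `I × X`. -/
structure IsContinuousWeightFamily (I : Set ℝ) (w : ℝ → ℕ → ℝ) : Prop where
  admissible : ∀ a ∈ I, IsAdmissible X (w a)
  continuousOn_weight : ∀ n : ℕ, 1 ≤ n → ContinuousOn (fun a => w a n) I
  continuousOn_shift :
    ContinuousOn (fun q : ℝ × X => backwardShift X (w q.1) q.2) (I ×ˢ Set.univ)

/-- The product operator `B_{w(λ₁)} × ⋯ × B_{w(λ_d)}` on `X^d`. -/
def productShift {d : ℕ} (w : ℝ → ℕ → ℝ) (l : Fin d → ℝ) : (Fin d → X) →L[ℂ] (Fin d → X) :=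
  ContinuousLinearMap.pi fun i =>
    (backwardShift X (w (l i))).comp (ContinuousLinearMap.proj i)

end Shifts

/-! ### Hypercyclicity -/

/-- `x` is a hypercyclic vector of `T`: the orbit `{T^n x : n ≥ 1}` is dense. -/
def IsHypercyclicVector {Y : Type*} [AddCommGroup Y] [Module ℂ Y] [TopologicalSpace Y]
    (T : Y →L[ℂ] Y) (x : Y) : Prop :=
  Dense {y : Y | ∃ n : ℕ, 1 ≤ n ∧ (⇑T)^[n] x = y}

/-- The family `(T_l)_{l ∈ L}` admits a common hypercyclic algebra: there is a non-zero
subalgebra of `Y` all of whose non-zero elements are hypercyclic for every `T_l`, `l ∈ L`. -/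
def HasCommonHypercyclicAlgebra {Y P : Type*} [NonUnitalCommRing Y] [Module ℂ Y]
    [TopologicalSpace Y] (L : Set P) (T : P → Y →L[ℂ] Y) : Prop :=
  ∃ A : NonUnitalSubalgebra ℂ Y, (∃ x ∈ A, x ≠ 0) ∧
    ∀ x ∈ A, x ≠ 0 → ∀ l ∈ L, IsHypercyclicVector (T l) x

/-- The growth assumptions on the weights: on each compact `I₀ ⊆ I`, for suitable
`D₁, D₂, D₃ > 0` and all large `n`, the map `a ↦ ∑_{i=1}^n log w_i(a)` is
`D₁ n^α`-Lipschitz and `w_1(a) ⋯ w_n(a) ≥ D₂ exp (D₃ n^α)`. -/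
def PowerGrowthCondition (α : ℝ) (I : Set ℝ) (w : ℝ → ℕ → ℝ) : Prop :=
  ∀ I₀ ⊆ I, IsCompact I₀ → ∃ D₁ > (0 : ℝ), ∃ D₂ > (0 : ℝ), ∃ D₃ > (0 : ℝ), ∃ N : ℕ, ∀ n ≥ N,
    (∀ a ∈ I₀, ∀ b ∈ I₀,
      |∑ i ∈ Finset.Icc 1 n, Real.log (w a i) - ∑ i ∈ Finset.Icc 1 n, Real.log (w b i)|
        ≤ D₁ * (n : ℝ) ^ α * |a - b|) ∧
    ∀ a ∈ I₀, D₂ * Real.exp (D₃ * (n : ℝ) ^ α) ≤ ∏ i ∈ Finset.Icc 1 n, w a i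

end

/-!
The algebra is generated by one vector `x ∈ X^d`, found by Baire's theorem: its elements are the
values `P(x)` of the polynomials without constant term. Cut the parameter set into countably many
compact pieces `K`, and, up to a scalar factor, the polynomials into countably many compact
sets `Γ` of polynomials `z ^ m + (higher terms)`. For `V` in a countable base, the set of the `x`
such that for all `l ∈ K` and `P ∈ Γ` some `T_l^n P(x)` lies in `V` is open by compactness
(`isOpen_visitingVectors`), and a common point of all these sets generates a suitable algebra.

The point is density (`dense_visitingVectors`, whose quantitative content is `exists_coordinates`).
Given finitely supported `u` and `y`, choose times `n` and parameters `φ n`, and add to `u`, near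
position `n`, coordinatewise `m`-th roots of the vector supported there that the `n`-th power of
the shift with parameter `φ n` maps to `y`. The higher powers of these small coordinates are
negligible, so that `T_l^n P(x)` reproduces `y`, as long as `l - φ n` is small compared with
`n^(-α)`. The blocks at later times `n'` contribute at most `exp (D₁ n'^α |l - φ n'| - D₃ (n' - n)^α)`, up to a constant.

So the `φ n`, for times `n` of order `N`, must form a net of `K` of mesh a small multiple
of `N^(-α)`, while `|φ n - φ n'|` is at most a small multiple of `(|n - n'| / N)^α`: the map `φ` is
a discrete `α`-Hölder parametrization of a `d`-dimensional set. The condition `α < 1 / d` leaves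
room to build one by a plain self-similar construction (`exists_holder_net`): with `B = 2 b^d`
and `b` large, `B^α < b`, so that `b^d` subcubes of side `1 / b` can be visited during intervals
of length `1 / B` separated by gaps of the same length. Taking `K` in a small enough
cube makes the Hölder constant as small as needed (`exists_separated_times`).
-/

/-! ### Hölder nets of cubes -/

theorem exists_base_rpow_lt {d : ℕ} (hd : 1 ≤ d) {α : ℝ} (hα₁ : α < 1 / (d : ℝ)) :
    ∃ b : ℕ, 2 ≤ b ∧ ((2 * b ^ d : ℕ) : ℝ) ^ α < b := by
  have hd' : (0 : ℝ) < d := by exact_mod_cast hd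
  have h1 : 0 < 1 - d * α := by
    have := (lt_div_iff₀ hd').1 hα₁
    linarith
  have ht := ((tendsto_rpow_atTop h1).comp tendsto_natCast_atTop_atTop).eventually_gt_atTop
    ((2 : ℝ) ^ α)
  obtain ⟨b, hb, hb2⟩ := (ht.and (Filter.eventually_ge_atTop 2)).exists
  refine ⟨b, hb2, ?_⟩
  have hb0 : (0 : ℝ) < b := by positivity
  have h2 : (2 : ℝ) ^ α < (b : ℝ) ^ (1 - d * α) := hb
  push_cast
  rw [Real.mul_rpow (by norm_num) (by positivity), ← Real.rpow_natCast, ← Real.rpow_mul hb0.le]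
  calc (2 : ℝ) ^ α * (b : ℝ) ^ (d * α) < (b : ℝ) ^ (1 - d * α) * (b : ℝ) ^ (d * α) := by
        gcongr
    _ = b := by rw [← Real.rpow_add hb0]; simp

theorem exists_nat_le_mul_le_succ {b : ℕ} (hb : 1 ≤ b) {y : ℝ} (h0 : 0 ≤ y) (h1 : y ≤ 1) :
    ∃ q : Fin b, (q : ℝ) ≤ b * y ∧ b * y ≤ q + 1 := by
  have hb0 : (0 : ℝ) < b := by positivity
  by_cases h : y = 1
  · refine ⟨⟨b - 1, by omega⟩, ?_, ?_⟩ <;> simp [h, Nat.cast_sub hb]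
  · have hy : (b : ℝ) * y < b := by
      have := lt_of_le_of_ne h1 h
      nlinarith
    have h2 : 0 ≤ (b : ℝ) * y := by positivity
    exact ⟨⟨⌊(b : ℝ) * y⌋₊, (Nat.floor_lt h2).2 hy⟩, Nat.floor_le h2, (Nat.lt_floor_add_one _).le⟩

/-- A discrete Hölder parametrization of a subset `K` of a cube of side `ρ`. At level `m`, the
times `t` lie in `[0, B^m)`, where `B = 2 b^d`. At level `m + 1`, the `b^d` subcubes are visited
one after the other, each during a group of `B^m` times, with gaps of `B^m` times in between.
Because of the gaps, points of distinct subcubes are only compared at large time differences, so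
that the parametrization is `α`-Hölder as soon as `B^α ≤ b`. -/
theorem exists_holder_net {d b : ℕ} {α : ℝ} (hα₀ : 0 < α) (hb : 1 ≤ b)
    (hB : ((2 * b ^ d : ℕ) : ℝ) ^ α ≤ b) (m : ℕ) :
    ∀ (ρ : ℝ), 0 < ρ → ∀ (c : Fin d → ℝ) (K : Set (Fin d → ℝ)),
      (∀ x ∈ K, ∀ i, c i ≤ x i ∧ x i ≤ c i + ρ) →
      ∃ (ι : Type) (t : ι → ℕ) (φ : ι → Fin d → ℝ),
        (∀ l, t l < (2 * b ^ d) ^ m) ∧ (∀ l, φ l ∈ K) ∧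
        (∀ l l', l ≠ l' → t l ≠ t l' ∧ ∀ i, |φ l i - φ l' i| ≤
          b * ρ * (|(t l : ℝ) - t l'| / ((2 * b ^ d : ℕ) : ℝ) ^ m) ^ α) ∧
        ∀ x ∈ K, ∃ l, ∀ i, |x i - φ l i| ≤ ρ / (b : ℝ) ^ m := by
  have hb0 : (0 : ℝ) < b := by exact_mod_cast hb
  induction m with
  | zero =>
    intro ρ hρ c K hK
    refine ⟨PLift K.Nonempty, fun _ => 0, fun l => l.down.some, by simp, fun l => l.down.some_mem,
      fun l l' h => absurd (Subsingleton.elim l l') h, fun x hx => ⟨⟨⟨x, hx⟩⟩, fun i => ?_⟩⟩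
    have h1 := hK x hx i
    have h2 := hK _ (Set.Nonempty.some_mem ⟨x, hx⟩) i
    rw [pow_zero, div_one, abs_le]
    constructor <;> linarith
  | succ m ih =>
    intro ρ hρ c K hK
    have hρb : 0 < ρ / b := by positivity
    set B : ℕ := 2 * b ^ d with hBdef
    have hB1 : 1 ≤ B := by have := pow_pos (by omega : 0 < b) d; omega
    have hBr : (0 : ℝ) < B := by exact_mod_cast hB1
    have hBm : 0 < B ^ m := pow_pos hB1 m
    have hBmr : (0 : ℝ) < (B : ℝ) ^ m := by positivity
    choose ι t φ h1 h2 h3 h4 using fun q : Fin d → Fin b =>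
      ih (ρ / b) hρb (fun i => c i + q i * (ρ / b))
        {x ∈ K | ∀ i, c i + q i * (ρ / b) ≤ x i ∧ x i ≤ c i + q i * (ρ / b) + ρ / b}
        fun x hx => hx.2
    let E : (Fin d → Fin b) ≃ Fin (b ^ d) := finFunctionFinEquiv
    refine ⟨Σ q, ι q, fun l => 2 * (E l.1 : ℕ) * B ^ m + t l.1 l.2, fun l => φ l.1 l.2,
      fun l => ?_, fun l => (h2 l.1 l.2).1, ?_, fun x hx => ?_⟩
    · have h := h1 l.1 l.2
      have hE : (E l.1 : ℕ) + 1 ≤ b ^ d := (E l.1).2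
      calc 2 * (E l.1 : ℕ) * B ^ m + t l.1 l.2 < 2 * (E l.1 : ℕ) * B ^ m + 2 * B ^ m := by omega
        _ = 2 * ((E l.1 : ℕ) + 1) * B ^ m := by ring
        _ ≤ 2 * b ^ d * B ^ m := by gcongr
        _ = B ^ (m + 1) := by rw [← hBdef]; ring
    · rintro ⟨q, l⟩ ⟨q', l'⟩ hne
      by_cases hq : q = q'
      · subst hq
        have hl : l ≠ l' := fun h => hne (by rw [h])
        obtain ⟨h5, h6⟩ := h3 q l l' hl
        refine ⟨by simpa using h5, fun i => (h6 i).trans ?_⟩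
        have hx : 0 ≤ |(t q l : ℝ) - t q l'| / (B : ℝ) ^ (m + 1) := by positivity
        have hy : |(t q l : ℝ) - t q l'| / (B : ℝ) ^ m
            = B * (|(t q l : ℝ) - t q l'| / (B : ℝ) ^ (m + 1)) := by
          rw [pow_succ]; field_simp
        rw [hy, Real.mul_rpow hBr.le hx]
        have hz : |((2 * (E q : ℕ) * B ^ m + t q l : ℕ) : ℝ) - (2 * (E q : ℕ) * B ^ m + t q l' : ℕ)|
            = |(t q l : ℝ) - t q l'| := by
          push_cast; congr 1; ring
        simp only [hz]
        have hp := Real.rpow_nonneg hx α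
        set z := (|(t q l : ℝ) - t q l'| / (B : ℝ) ^ (m + 1)) ^ α
        calc b * (ρ / b) * ((B : ℝ) ^ α * z) ≤ b * (ρ / b) * (b * z) := by gcongr
          _ = b * ρ * z := by field_simp
      · have hEq : (E q : ℕ) ≠ E q' := fun h => hq (E.injective (Fin.ext h))
        have ht := h1 q l
        have ht' := h1 q' l'
        have key : B ^ m ≤ Int.natAbs (((2 * (E q : ℕ) * B ^ m + t q l : ℕ) : ℤ)
            - (2 * (E q' : ℕ) * B ^ m + t q' l' : ℕ)) := by
          rcases lt_or_gt_of_ne hEq with h | h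
          · have h7 : 2 * (E q : ℕ) * B ^ m + 2 * B ^ m ≤ 2 * (E q' : ℕ) * B ^ m := by
              calc _ = 2 * ((E q : ℕ) + 1) * B ^ m := by ring
                _ ≤ _ := by gcongr; exact h
            omega
          · have h7 : 2 * (E q' : ℕ) * B ^ m + 2 * B ^ m ≤ 2 * (E q : ℕ) * B ^ m := by
              calc _ = 2 * ((E q' : ℕ) + 1) * B ^ m := by ring
                _ ≤ _ := by gcongr; exact h
            omega
        have key' : (B : ℝ) ^ m ≤ |((2 * (E q : ℕ) * B ^ m + t q l : ℕ) : ℝ)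
            - (2 * (E q' : ℕ) * B ^ m + t q' l' : ℕ)| := by
          have h8 : ((B ^ m : ℕ) : ℝ) ≤ ((Int.natAbs (((2 * (E q : ℕ) * B ^ m + t q l : ℕ) : ℤ)
            - (2 * (E q' : ℕ) * B ^ m + t q' l' : ℕ)) : ℕ) : ℝ) := by exact_mod_cast key
          rw [Nat.cast_natAbs] at h8
          push_cast at h8 ⊢
          exact h8
        refine ⟨fun h => ?_, fun i => ?_⟩
        · simp only at h
          rw [h, sub_self] at key
          simp at key
          omega
        · have h5 := hK _ (h2 q l).1 i
          have h6 := hK _ (h2 q' l').1 i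
          have h7 : |φ q l i - φ q' l' i| ≤ ρ := by rw [abs_le]; constructor <;> linarith
          refine h7.trans ?_
          have h9 : (1 : ℝ) ≤ b * (1 / (B : ℝ)) ^ α := by
            rw [Real.div_rpow zero_le_one hBr.le, Real.one_rpow, mul_one_div,
              one_le_div (by positivity)]
            exact hB
          have h10 : 1 / (B : ℝ) ≤ |((2 * (E q : ℕ) * B ^ m + t q l : ℕ) : ℝ)
              - (2 * (E q' : ℕ) * B ^ m + t q' l' : ℕ)| / (B : ℝ) ^ (m + 1) := by
            rw [div_le_div_iff₀ hBr (by positivity), pow_succ, one_mul]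
            gcongr
          calc ρ = ρ * 1 := (mul_one _).symm
            _ ≤ ρ * (b * (1 / (B : ℝ)) ^ α) := by gcongr
            _ = b * ρ * (1 / (B : ℝ)) ^ α := by ring
            _ ≤ _ := by gcongr
    · have h5 : ∀ i, ∃ q : Fin b, c i + q * (ρ / b) ≤ x i ∧ x i ≤ c i + q * (ρ / b) + ρ / b := by
        intro i
        obtain ⟨h6, h7⟩ := hK x hx i
        obtain ⟨q, h8, h9⟩ := exists_nat_le_mul_le_succ hb (y := (x i - c i) / ρ)
          (div_nonneg (by linarith) hρ.le) ((div_le_one hρ).2 (by linarith))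
        refine ⟨q, ?_, ?_⟩
        · have := mul_le_mul_of_nonneg_right h8 hρb.le
          have h10 : b * ((x i - c i) / ρ) * (ρ / b) = x i - c i := by field_simp
          linarith
        · have := mul_le_mul_of_nonneg_right h9 hρb.le
          have h10 : b * ((x i - c i) / ρ) * (ρ / b) = x i - c i := by field_simp
          linarith
      choose q hq using h5
      obtain ⟨l, hl⟩ := h4 q x ⟨hx, hq⟩
      refine ⟨⟨q, l⟩, fun i => (hl i).trans (le_of_eq ?_)⟩
      rw [pow_succ]; field_simp

/-- The family of hitting times used for all parameters in a small cube: parameters attached to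
the times `n ∈ [N, 2N]` form a `τ / N^α`-net of `K`, while parameters attached to two distinct
times differ by at most `η (|n - n'| / N)^α`, and the times are `L`-separated. -/
theorem exists_separated_times {d : ℕ} (hd : 1 ≤ d) {α : ℝ} (hα₀ : 0 < α)
    (hα₁ : α < 1 / (d : ℝ)) {η : ℝ} (hη : 0 < η) :
    ∃ ρ > (0 : ℝ), ∀ (c : Fin d → ℝ) (K : Set (Fin d → ℝ)),
      (∀ x ∈ K, ∀ i, c i ≤ x i ∧ x i ≤ c i + ρ) → ∀ τ > (0 : ℝ), ∀ L : ℕ, 1 ≤ L → ∀ N₁ : ℕ,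
      ∃ N ≥ N₁, ∃ (ι : Type) (n : ι → ℕ) (φ : ι → Fin d → ℝ),
        (∀ l, N ≤ n l ∧ n l ≤ 2 * N) ∧ (∀ l, φ l ∈ K) ∧
        (∀ l l', l ≠ l' → n l ≤ n l' → n l + L ≤ n l' ∧
          ∀ i, |φ l i - φ l' i| * (N : ℝ) ^ α ≤ η * ((n l' - n l : ℕ) : ℝ) ^ α) ∧
        ∀ x ∈ K, ∃ l, ∀ i, |x i - φ l i| * (N : ℝ) ^ α ≤ τ := by
  obtain ⟨b, hb2, hB⟩ := exists_base_rpow_lt hd hα₁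
  have hb1 : 1 ≤ b := by omega
  have hb0 : (0 : ℝ) < b := by exact_mod_cast hb1
  refine ⟨η / b, by positivity, fun c K hK τ hτ L hL N₁ => ?_⟩
  set B : ℕ := 2 * b ^ d with hBdef
  have hB2 : 2 ≤ B := by have := pow_pos (by omega : 0 < b) d; omega
  have hBr : (0 : ℝ) < B := by positivity
  have hLr : (0 : ℝ) < L := by exact_mod_cast hL
  have hq : (B : ℝ) ^ α / b < 1 := (div_lt_one hb0).2 hB
  have hlim := (tendsto_pow_atTop_nhds_zero_of_lt_one (by positivity) hq).const_mul
    (η / b * (L : ℝ) ^ α)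
  rw [mul_zero] at hlim
  obtain ⟨m, hm, hmN⟩ := ((hlim.eventually (gt_mem_nhds hτ)).and
    (Filter.eventually_ge_atTop N₁)).exists
  obtain ⟨ι, t, φ, h1, h2, h3, h4⟩ := exists_holder_net hα₀ hb1 hB.le m (η / b) (by positivity)
    c K hK
  rw [← hBdef] at h1 h3
  have hBm : 0 < B ^ m := pow_pos (by omega) m
  have hNr : (0 : ℝ) < ((L * B ^ m : ℕ) : ℝ) := by positivity
  refine ⟨L * B ^ m, ?_, ι, fun l => L * B ^ m + L * t l, φ,
    fun l => ⟨Nat.le_add_right _ _, ?_⟩, h2, ?_, ?_⟩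
  · have h5 : m < B ^ m := Nat.lt_pow_self (by omega)
    nlinarith
  · have := h1 l
    nlinarith
  · intro l l' hne hle
    obtain ⟨h5, h6⟩ := h3 l l' hne
    have h7 : t l < t l' := by
      refine lt_of_le_of_ne ?_ h5
      by_contra hlt
      push Not at hlt
      nlinarith
    refine ⟨by nlinarith, fun i => ?_⟩
    have h8 : L * B ^ m + L * t l' - (L * B ^ m + L * t l) = L * (t l' - t l) := by
      rw [Nat.mul_sub]; omega
    have h9 : ((L * (t l' - t l) : ℕ) : ℝ)
        = |(t l : ℝ) - t l'| / (B : ℝ) ^ m * ((L * B ^ m : ℕ) : ℝ) := by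
      have : (t l : ℝ) < t l' := by exact_mod_cast h7
      rw [abs_of_neg (by linarith)]
      push_cast [Nat.cast_sub h7.le]
      field_simp
      ring
    rw [h8, h9, Real.mul_rpow (by positivity) hNr.le, ← mul_assoc]
    refine mul_le_mul_of_nonneg_right ((h6 i).trans (le_of_eq ?_)) (by positivity)
    field_simp
  · intro x hx
    obtain ⟨l, hl⟩ := h4 x hx
    refine ⟨l, fun i => le_trans (mul_le_mul_of_nonneg_right (hl i) (by positivity)) ?_⟩
    refine le_trans (le_of_eq ?_) hm.le
    push_cast
    rw [Real.mul_rpow hLr.le (by positivity), ← Real.rpow_natCast (B : ℝ), ← Real.rpow_mul hBr.le,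
      mul_comm (m : ℝ) α, Real.rpow_mul hBr.le, Real.rpow_natCast, div_pow]
    field_simp

/-! ### Tails of the series of `exp (-c n^α)` -/

theorem summable_exp_neg_mul_rpow {c α : ℝ} (hc : 0 < c) (hα : 0 < α) :
    Summable fun n : ℕ => Real.exp (-c * (n : ℝ) ^ α) := by
  have h1 := isLittleO_exp_neg_mul_rpow_atTop hc (-2 / α)
  have h2 := (h1.comp_tendsto ((tendsto_rpow_atTop hα).comp tendsto_natCast_atTop_atTop)).isBigO
  refine summable_of_isBigO_nat (g := fun n : ℕ => (n : ℝ) ^ (-2 : ℝ))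
    (Real.summable_nat_rpow.2 (by norm_num)) (h2.congr_right fun n => ?_)
  simp only [Function.comp]
  rw [← Real.rpow_mul (Nat.cast_nonneg n)]
  congr 1
  field_simp

theorem exists_sum_Ico_exp_lt {c α : ℝ} (hc : 0 < c) (hα : 0 < α) {C δ : ℝ}
    (hδ : 0 < δ) :
    ∃ L₀ : ℕ, ∀ L ≥ L₀, ∀ R, ∑ r ∈ Finset.Ico L R, C * Real.exp (-c * (r : ℝ) ^ α) < δ := by
  have hs := (summable_exp_neg_mul_rpow hc hα).mul_left C
  obtain ⟨s, hs'⟩ := summable_iff_vanishing_norm.1 hs δ hδ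
  obtain ⟨L₀, hL₀⟩ := s.exists_nat_subset_range
  refine ⟨L₀, fun L hL R => lt_of_le_of_lt (le_abs_self _) (hs' _ ?_)⟩
  rw [Finset.disjoint_left]
  intro x hx hx'
  have := Finset.mem_range.1 (hL₀ hx')
  have := (Finset.mem_Ico.1 hx).1
  omega

/-! ### Coordinates of an approximating vector -/

/-- Positive functions `W n` on `K₀`, thought of as the products `a ↦ w_1(a) ⋯ w_n(a)`, that are
continuous and, for `n ≥ N₀`, at least `D₂ exp (D₃ n^α)`, with `D₁ n^α`-Lipschitz
logarithms. -/
structure IsGrowingProduct (α : ℝ) (K₀ : Set ℝ) (W : ℝ → ℕ → ℝ) (D₁ D₂ D₃ : ℝ) (N₀ : ℕ) :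
    Prop where
  pos : ∀ a ∈ K₀, ∀ n, 0 < W a n
  continuousOn : ∀ n, ContinuousOn (fun a => W a n) K₀
  le_mul_exp : ∀ n ≥ N₀, ∀ a ∈ K₀, ∀ b ∈ K₀,
    W a n ≤ W b n * Real.exp (D₁ * (n : ℝ) ^ α * |a - b|)
  exp_le : ∀ n ≥ N₀, ∀ a ∈ K₀, D₂ * Real.exp (D₃ * (n : ℝ) ^ α) ≤ W a n

namespace IsGrowingProduct

variable {α : ℝ} {K₀ : Set ℝ} {W : ℝ → ℕ → ℝ} {D₁ D₂ D₃ : ℝ} {N₀ : ℕ}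

theorem exists_bound (hW : IsGrowingProduct α K₀ W D₁ D₂ D₃ N₀) (hK₀ : IsCompact K₀) (J : ℕ) :
    ∃ C ≥ (1 : ℝ), ∀ j < J, ∀ a ∈ K₀, W a j ≤ C := by
  choose C hC using fun j => hK₀.bddAbove_image (hW.continuousOn j)
  refine ⟨1 + ∑ j ∈ Finset.range J, |C j|, by
    linarith [Finset.sum_nonneg fun j (_ : j ∈ Finset.range J) => abs_nonneg (C j)],
    fun j hj a ha => ?_⟩
  have h1 : W a j ≤ C j := hC j ⟨a, ha, rfl⟩
  have h2 := Finset.single_le_sum (f := fun j => |C j|) (fun j _ => abs_nonneg (C j))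
    (Finset.mem_range.2 hj)
  have h3 := le_abs_self (C j)
  linarith

theorem exists_uniform (hW : IsGrowingProduct α K₀ W D₁ D₂ D₃ N₀) (hK₀ : IsCompact K₀) (J : ℕ)
    {θ : ℝ} (hθ : 0 < θ) :
    ∃ δ > (0 : ℝ), ∀ j < J, ∀ a ∈ K₀, ∀ b ∈ K₀, |a - b| < δ → W a j ≤ W b j * Real.exp θ := by
  have h : ∀ j, ∃ δ > (0 : ℝ), ∀ a ∈ K₀, ∀ b ∈ K₀, |a - b| < δ → W a j ≤ W b j * Real.exp θ := by
    intro j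
    have hc : ContinuousOn (fun a => Real.log (W a j)) K₀ :=
      (hW.continuousOn j).log fun a ha => (hW.pos a ha j).ne'
    obtain ⟨δ, hδ, h⟩ := Metric.uniformContinuousOn_iff.1
      (hK₀.uniformContinuousOn_of_continuous hc) θ hθ
    refine ⟨δ, hδ, fun a ha b hb hab => ?_⟩
    have h1 := (abs_lt.1 (h a ha b hb hab)).2
    rw [← Real.exp_log (hW.pos a ha j), ← Real.exp_log (hW.pos b hb j), ← Real.exp_add]
    exact Real.exp_le_exp.2 (by linarith)
  choose δ hδ h using h
  induction J with
  | zero => exact ⟨1, one_pos, by simp⟩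
  | succ J ih =>
    obtain ⟨δ', hδ', h'⟩ := ih
    refine ⟨min δ' (δ J), lt_min hδ' (hδ J), fun j hj a ha b hb hab => ?_⟩
    rcases Nat.lt_succ_iff_lt_or_eq.1 hj with hj | rfl
    · exact h' j hj a ha b hb (hab.trans_le (min_le_left _ _))
    · exact h j a ha b hb (hab.trans_le (min_le_right _ _))

end IsGrowingProduct

/-- The scalar form of the density of the vectors whose polynomials reach a given target `y` at
some time, for all parameters `x ∈ K`. The vector with coordinates `a i` is a small perturbation
of `u i`, and for every parameter `x ∈ K` some time `n` is such that, for every `p` close to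
`z ↦ z ^ m` at the origin, shifting `p (a i)` `n` times gives a vector close to `y i`. Here
`W (x i) n` is the product of the first `n` weights at the parameter `x i`. -/
def HasApproximatingCoordinates {d : ℕ} (W : ℝ → ℕ → ℝ) (K : Set (Fin d → ℝ)) : Prop :=
  ∀ (u y : Fin d → ℕ → ℂ) (J : ℕ), ∀ ε > (0 : ℝ), ∀ m : ℕ, 1 ≤ m → ∀ Q : ℝ, 0 ≤ Q →
  ∃ (R : ℕ) (a : Fin d → ℕ → ℂ), J ≤ R ∧ (∀ i, ∀ k < J, a i k = u i k) ∧
    (∀ i, ∑ k ∈ Finset.Ico J R, ‖a i k‖ < ε) ∧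
    ∀ x ∈ K, ∃ n ≥ 1, n + J ≤ R ∧ ∀ p : ℂ → ℂ,
      (∀ z, ‖z‖ ≤ 1 → ‖p z - z ^ m‖ ≤ Q * ‖z‖ ^ (m + 1)) → ∀ i,
      ∑ j ∈ Finset.range J,
        ‖p (a i (n + j)) * ((W (x i) (n + j) / W (x i) j : ℝ) : ℂ) - y i j‖ < ε ∧
      ∑ r ∈ Finset.Ico J (R - n), ‖p (a i (n + r))‖ * (W (x i) (n + r) / W (x i) r) < ε

/-- Values `v l j` placed at the positions `n l + j`, `j < J`, when these positions are separated,
after the `J` first values of `u`. -/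
theorem exists_block_sequence {ι : Type} {J N : ℕ} (n : ι → ℕ) (hJ : J ≤ N) (hN : ∀ l, N ≤ n l)
    (hsep : ∀ l l', l ≠ l' → n l ≤ n l' → n l + J ≤ n l') (u : ℕ → ℂ) (v : ι → ℕ → ℂ) :
    ∃ a : ℕ → ℂ, (∀ k < J, a k = u k) ∧ (∀ l, ∀ j < J, a (n l + j) = v l j) ∧
      ∀ k ≥ J, a k ≠ 0 → ∃ l, ∃ j < J, k = n l + j := by
  classical
  refine ⟨fun k => if k < J then u k else if h : ∃ l, n l ≤ k ∧ k < n l + J then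
    v h.choose (k - n h.choose) else 0, fun k hk => if_pos hk, fun l j hj => ?_, fun k hk h => ?_⟩
  · have hl := hN l
    have h : ∃ l', n l' ≤ n l + j ∧ n l + j < n l' + J := ⟨l, by omega, by omega⟩
    have h' : h.choose = l := by
      have h1 := h.choose_spec
      by_contra hne
      rcases le_total (n h.choose) (n l) with h2 | h2
      · have := hsep _ _ hne h2
        omega
      · have := hsep _ _ (Ne.symm hne) h2
        omega
    simp only
    rw [if_neg (by omega), dif_pos h, h', Nat.add_sub_cancel_left]
  · simp only at h
    rw [if_neg (by omega)] at h
    by_cases h' : ∃ l, n l ≤ k ∧ k < n l + J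
    · obtain ⟨l, h1, h2⟩ := h'
      exact ⟨l, k - n l, by omega, by omega⟩
    · exact absurd (dif_neg h') h

theorem abs_sub_one_le_of_le_of_one_le_mul {s E : ℝ} (hE : 1 ≤ E) (h1 : s ≤ E)
    (h2 : 1 ≤ s * E) : |s - 1| ≤ E - 1 := by
  rw [abs_le]
  constructor
  · nlinarith [sq_nonneg (E - 1)]
  · linarith

set_option maxHeartbeats 1000000 in
/-- The coordinates `a i` following each of the times `t l` are `m`-th roots such that shifting
`a i ^ m` by `t l` gives `y i` at the parameter `φ l`. For `x` close to `φ l`, the values following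
a later time `t l'` contribute at most a constant times
`exp (D₁ (t l')^α |x - φ l'| - D₃ (t l' - t l)^α)`, which the Hölder bound on `|φ l - φ l'|` makes
summable. -/
theorem exists_coordinates {d : ℕ} (hd : 1 ≤ d) {α : ℝ} (hα₀ : 0 < α) (hα₁ : α < 1 / (d : ℝ))
    {D₁ D₂ D₃ : ℝ} (hD₁ : 0 < D₁) (hD₂ : 0 < D₂) (hD₃ : 0 < D₃) :
    ∃ ρ > (0 : ℝ), ∀ (K₀ : Set ℝ) (W : ℝ → ℕ → ℝ) (N₀ : ℕ), IsCompact K₀ →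
      IsGrowingProduct α K₀ W D₁ D₂ D₃ N₀ → ∀ (c : Fin d → ℝ) (K : Set (Fin d → ℝ)),
      (∀ x ∈ K, ∀ i, x i ∈ K₀) → (∀ x ∈ K, ∀ i, c i ≤ x i ∧ x i ≤ c i + ρ) →
      HasApproximatingCoordinates W K := by
  -- With this Hölder constant, `3 D₁ |φ l - φ l'| N^α` is at most half of `D₃ (t l' - t l)^α`.
  obtain ⟨ρ, hρ, hnet⟩ := exists_separated_times hd hα₀ hα₁ (η := D₃ / (6 * D₁)) (by positivity)
  refine ⟨ρ, hρ, fun K₀ W N₀ hK₀ hW c K hKK₀ hKc u y J ε hε m hm Q hQ => ?_⟩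
  have hα1 : α ≤ 1 := by
    refine hα₁.le.trans ((div_le_one (by positivity)).2 (by exact_mod_cast hd))
  obtain ⟨C₀, hC₀, hWC⟩ := hW.exists_bound hK₀ J
  obtain ⟨Y, hY1, hY⟩ : ∃ Y ≥ (1 : ℝ), ∀ i, ∀ j < J, ‖y i j‖ ≤ Y := by
    refine ⟨1 + ∑ i, ∑ j ∈ Finset.range J, ‖y i j‖, ?_, fun i j hj => ?_⟩
    · have : 0 ≤ ∑ i, ∑ j ∈ Finset.range J, ‖y i j‖ := by positivity
      linarith
    · have h1 := Finset.single_le_sum (f := fun j => ‖y i j‖) (fun j _ => norm_nonneg _)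
        (Finset.mem_range.2 hj)
      have h2 := Finset.single_le_sum (f := fun i => ∑ j ∈ Finset.range J, ‖y i j‖)
        (fun i _ => by positivity) (Finset.mem_univ i)
      linarith
  have hY0 : 0 < Y := by linarith
  have hC0 : 0 < C₀ := by linarith
  -- `δ₁` is the error allowed for each of the first `J` coordinates.
  obtain ⟨δ₁, hδ₁, hδ₁J⟩ : ∃ δ₁ > (0 : ℝ), J * δ₁ < ε := by
    refine ⟨ε / (J + 1), by positivity, ?_⟩
    rw [← mul_div_assoc, div_lt_iff₀ (by positivity)]
    nlinarith
  -- `exp (2 θ)` bounds the distortion of the weights between nearby parameters.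
  obtain ⟨θ, hθ, hθ2, hθY⟩ : ∃ θ > (0 : ℝ), Real.exp (2 * θ) ≤ 2 ∧
      Y * (Real.exp (2 * θ) - 1) ≤ δ₁ / 2 := by
    have hlim : Filter.Tendsto (fun θ : ℝ => Real.exp (2 * θ)) (nhds 0) (nhds 1) := by
      have : Continuous fun θ : ℝ => Real.exp (2 * θ) := by fun_prop
      simpa using this.tendsto 0
    have hs : 0 < min 1 (δ₁ / 2 / Y) := by positivity
    obtain ⟨θ, h1, h2⟩ := ((hlim.eventually (ge_mem_nhds (by linarith :
      (1 : ℝ) < 1 + min 1 (δ₁ / 2 / Y)))).filter_mono nhdsWithin_le_nhds |>.and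
        (self_mem_nhdsWithin (s := Set.Ioi (0 : ℝ)))).exists
    have h3 := min_le_left 1 (δ₁ / 2 / Y)
    have h4 := min_le_right 1 (δ₁ / 2 / Y)
    refine ⟨θ, h2, by linarith, ?_⟩
    have h5 : Real.exp (2 * θ) - 1 ≤ δ₁ / 2 / Y := by linarith
    calc Y * (Real.exp (2 * θ) - 1) ≤ Y * (δ₁ / 2 / Y) := by gcongr
      _ = δ₁ / 2 := by field_simp
  obtain ⟨δ₀, hδ₀, hunif⟩ := hW.exists_uniform hK₀ J hθ
  -- `κ` bounds the coordinates placed at the times `n l`.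
  obtain ⟨κ, hκ, hκ1, hκQ, hκδ⟩ : ∃ κ > (0 : ℝ), κ ≤ 1 ∧ Q * κ ≤ 1 ∧
      2 * Q * κ * Y ≤ δ₁ / 2 := by
    have h1 : 0 < 1 + Q := by linarith
    have h3 : 0 < 1 + 4 * Q * Y := by positivity
    refine ⟨min (1 / (1 + Q)) (δ₁ / (1 + 4 * Q * Y)), by positivity, ?_, ?_, ?_⟩
    · refine (min_le_left _ _).trans ((div_le_one h1).2 (by linarith))
    · calc Q * _ ≤ Q * (1 / (1 + Q)) := by gcongr; exact min_le_left _ _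
        _ ≤ 1 := by rw [mul_one_div, div_le_one h1]; linarith
    · calc 2 * Q * _ * Y ≤ 2 * Q * (δ₁ / (1 + 4 * Q * Y)) * Y := by gcongr; exact min_le_right _ _
        _ = δ₁ / 2 * (4 * Q * Y / (1 + 4 * Q * Y)) := by ring
        _ ≤ δ₁ / 2 * 1 := by gcongr; rw [div_le_one h3]; linarith
        _ = δ₁ / 2 := mul_one _
  -- `C₁ exp (-(D₃ / 2) r^α)` will bound the contribution of the later blocks to the coordinate `r`,
  -- and `C₂ exp (-(D₃ / m) k^α)` the coordinate placed at position `k`.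
  set C₁ : ℝ := 4 * (Y * C₀) / D₂ with hC₁
  set C₂ : ℝ := max 1 (Y * C₀ / D₂) with hC₂
  obtain ⟨L₁, hL₁⟩ := exists_sum_Ico_exp_lt (c := D₃ / 2) (by positivity) hα₀ (C := C₁) hε
  have hm0 : (0 : ℝ) < m := by exact_mod_cast hm
  obtain ⟨L₂, hL₂⟩ := exists_sum_Ico_exp_lt (c := D₃ / m) (by positivity) hα₀ (C := C₂)
    (lt_min hε hκ)
  -- Positions are at most `3 N`, so this mesh distorts the weights by a factor at most `exp θ`.
  set τ : ℝ := θ / (3 * D₁) with hτ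
  have hτ0 : 0 < τ := by positivity
  obtain ⟨N₂, hN₂⟩ : ∃ N₂ : ℕ, ∀ N ≥ N₂, τ / δ₀ < (N : ℝ) ^ α := by
    have := ((tendsto_rpow_atTop hα₀).comp tendsto_natCast_atTop_atTop).eventually_gt_atTop (τ / δ₀)
    exact Filter.eventually_atTop.1 this
  set L : ℕ := max (max 1 J) (max N₀ L₁) with hL
  have hL1 : 1 ≤ L := by omega
  have hLJ : J ≤ L := by omega
  have hLN : N₀ ≤ L := by omega
  have hLL : L₁ ≤ L := by omega
  obtain ⟨N, hN, ι, t, φ, ht, hφ, hsep, hcov⟩ := hnet c K hKc τ hτ0 L hL1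
    (max (max L L₂) N₂)
  have hNL : L ≤ N := by omega
  have hNL₂ : L₂ ≤ N := by omega
  have hN₂' := hN₂ N (by omega)
  have hN0 : (0 : ℝ) < N := by exact_mod_cast (by omega : 0 < N)
  have hNα : (0 : ℝ) < (N : ℝ) ^ α := by positivity
  choose v hv using fun (i : Fin d) (l : ι) (j : ℕ) =>
    IsAlgClosed.exists_pow_nat_eq (y i j * ((W (φ l i) j / W (φ l i) (t l + j) : ℝ) : ℂ))
      (by omega : 0 < m)
  choose a hau hav ha0 using fun i => exists_block_sequence t (hLJ.trans hNL) (fun l => (ht l).1)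
    (fun l l' h h' => (Nat.add_le_add_left hLJ _).trans (hsep l l' h h').1) (u i) (v i)
  have hφ₀ : ∀ l i, φ l i ∈ K₀ := fun l i => hKK₀ _ (hφ l) i
  have hvm : ∀ i l, ∀ j, ‖v i l j‖ ^ m = ‖y i j‖ * W (φ l i) j / W (φ l i) (t l + j) := by
    intro i l j
    have h1 := hW.pos _ (hφ₀ l i) j
    have h2 := hW.pos _ (hφ₀ l i) (t l + j)
    rw [← norm_pow, hv, norm_mul, Complex.norm_real, Real.norm_of_nonneg (by positivity),
      mul_div_assoc]
  have hyC : ∀ i l, ∀ j < J, ‖y i j‖ * W (φ l i) j ≤ Y * C₀ := by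
    intro i l j hj
    have h1 := (hW.pos _ (hφ₀ l i) j).le
    have h2 := hY i j hj
    have h3 := hWC j hj _ (hφ₀ l i)
    gcongr
  -- The coordinates placed at `t l + j` are small.
  have hvsmall : ∀ i l, ∀ j < J,
      ‖v i l j‖ ≤ C₂ * Real.exp (-(D₃ / m) * ((t l + j : ℕ) : ℝ) ^ α) := by
    intro i l j hj
    have hk : N₀ ≤ t l + j := by have := (ht l).1; omega
    have h1 := hW.exp_le _ hk _ (hφ₀ l i)
    have hC2 : 1 ≤ C₂ := le_max_left _ _
    have hC2' : Y * C₀ / D₂ ≤ C₂ := le_max_right _ _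
    refine le_of_pow_le_pow_left₀ (by omega : m ≠ 0) (by positivity) ?_
    rw [hvm, mul_pow, ← Real.exp_nat_mul]
    have h2 : (m : ℝ) * (-(D₃ / m) * ((t l + j : ℕ) : ℝ) ^ α)
        = -(D₃ * ((t l + j : ℕ) : ℝ) ^ α) := by
      field_simp
    rw [h2, Real.exp_neg]
    calc ‖y i j‖ * W (φ l i) j / W (φ l i) (t l + j)
        ≤ Y * C₀ / (D₂ * Real.exp (D₃ * ((t l + j : ℕ) : ℝ) ^ α)) := by
          have := hyC i l j hj
          gcongr
      _ = Y * C₀ / D₂ * (Real.exp (D₃ * ((t l + j : ℕ) : ℝ) ^ α))⁻¹ := by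
          rw [div_mul_eq_div_div, div_eq_mul_inv (Y * C₀ / D₂)]
      _ ≤ C₂ ^ m * (Real.exp (D₃ * ((t l + j : ℕ) : ℝ) ^ α))⁻¹ := by
          have := le_self_pow₀ hC2 (by omega : m ≠ 0)
          have := hC2'.trans this
          gcongr
  have hC2pos : 0 < C₂ := lt_of_lt_of_le one_pos (le_max_left _ _)
  have hvκ : ∀ i l, ∀ j < J, ‖v i l j‖ ≤ κ := by
    intro i l j hj
    have h1 := hL₂ N hNL₂ (t l + j + 1)
    have h2 := Finset.single_le_sum
      (f := fun r : ℕ => C₂ * Real.exp (-(D₃ / m) * (r : ℝ) ^ α))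
      (fun r _ => by positivity)
      (Finset.mem_Ico.2 ⟨by have := (ht l).1; omega, by omega⟩ :
        t l + j ∈ Finset.Ico N (t l + j + 1))
    exact (hvsmall i l j hj).trans (h2.trans (h1.le.trans (min_le_right _ _)))
  refine ⟨3 * N, a, by omega, hau, fun i => ?_, fun x hx => ?_⟩
  · refine lt_of_le_of_lt ?_ ((hL₂ N hNL₂ (3 * N)).trans_le (min_le_left _ _))
    rw [← Finset.sum_subset (Finset.Ico_subset_Ico_left (hLJ.trans hNL))]
    · refine Finset.sum_le_sum fun k hk => ?_
      by_cases h : a i k = 0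
      · rw [h, norm_zero]; positivity
      · obtain ⟨l, j, hj, rfl⟩ := ha0 i k (by have := (Finset.mem_Ico.1 hk).1; omega) h
        rw [hav i l j hj]
        exact hvsmall i l j hj
    · intro k hk hk'
      by_contra h
      obtain ⟨l, j, hj, rfl⟩ := ha0 i k (Finset.mem_Ico.1 hk).1 (by simpa using h)
      rw [Finset.mem_Ico] at hk hk'
      have := (ht l).1
      omega
  obtain ⟨l, hl⟩ := hcov x hx
  have htl := ht l
  refine ⟨t l, by omega, by omega, fun p hp i => ?_⟩
  have hxi := hKK₀ x hx i
  -- Powers of positions up to `3 N` are controlled by `N ^ α`.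
  have hpow : ∀ k ≤ 3 * N, (k : ℝ) ^ α ≤ 3 * (N : ℝ) ^ α := by
    intro k hk
    calc (k : ℝ) ^ α ≤ (3 * N : ℝ) ^ α := by
          refine Real.rpow_le_rpow (by positivity) (by exact_mod_cast hk) hα₀.le
      _ = (3 : ℝ) ^ α * (N : ℝ) ^ α := Real.mul_rpow (by norm_num) hN0.le
      _ ≤ (3 : ℝ) ^ (1 : ℝ) * (N : ℝ) ^ α := by
          gcongr
          · norm_num
      _ = 3 * (N : ℝ) ^ α := by rw [Real.rpow_one]
  have hτθ : D₁ * 3 * τ = θ := by rw [hτ]; field_simp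
  have hxl : |x i - φ l i| < δ₀ := by
    have h1 := hl i
    rw [div_lt_iff₀ hδ₀] at hN₂'
    by_contra h
    push Not at h
    nlinarith
  have hpsmall : ∀ l j, j < J → ‖p (v i l j) - v i l j ^ m‖ ≤ Q * κ * ‖v i l j‖ ^ m := by
    intro l j hj
    have h1 := hvκ i l j hj
    refine (hp _ (h1.trans hκ1)).trans ?_
    rw [pow_succ]
    calc Q * (‖v i l j‖ ^ m * ‖v i l j‖) ≤ Q * (‖v i l j‖ ^ m * κ) := by gcongr
      _ = _ := by ring
  constructor
  · refine lt_of_le_of_lt (Finset.sum_le_card_nsmul _ _ δ₁ fun j hj => ?_)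
      (by rwa [Finset.card_range, nsmul_eq_mul])
    rw [Finset.mem_range] at hj
    rw [hav i l j hj]
    have p1 := hW.pos _ hxi (t l + j)
    have p2 := hW.pos _ hxi j
    have p3 := hW.pos _ (hφ₀ l i) (t l + j)
    have p4 := hW.pos _ (hφ₀ l i) j
    set q : ℝ := W (x i) (t l + j) / W (x i) j with hq
    have hq0 : 0 < q := by positivity
    set s : ℝ := W (φ l i) j / W (φ l i) (t l + j) * q with hs
    have hs0 : 0 < s := by positivity
    have hexp : D₁ * ((t l + j : ℕ) : ℝ) ^ α * |x i - φ l i| ≤ θ := by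
      have h1 := hpow (t l + j) (by omega)
      have h2 := hl i
      calc D₁ * ((t l + j : ℕ) : ℝ) ^ α * |x i - φ l i|
          ≤ D₁ * (3 * (N : ℝ) ^ α) * |x i - φ l i| := by gcongr
        _ = D₁ * 3 * (|x i - φ l i| * (N : ℝ) ^ α) := by ring
        _ ≤ D₁ * 3 * τ := by gcongr
        _ = θ := hτθ
    have hk : N₀ ≤ t l + j := by omega
    have e1 := (hW.le_mul_exp _ hk _ hxi _ (hφ₀ l i)).trans
      (mul_le_mul_of_nonneg_left (Real.exp_le_exp.2 hexp) p3.le)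
    have hexp' := hexp
    rw [abs_sub_comm] at hexp'
    have e2 := (hW.le_mul_exp _ hk _ (hφ₀ l i) _ hxi).trans
      (mul_le_mul_of_nonneg_left (Real.exp_le_exp.2 hexp') p1.le)
    have e3 := hunif j hj _ hxi _ (hφ₀ l i) hxl
    have e4 := hunif j hj _ (hφ₀ l i) _ hxi (by rwa [abs_sub_comm])
    have hexp2 : Real.exp (2 * θ) = Real.exp θ * Real.exp θ := by rw [two_mul, Real.exp_add]
    have hs1 : s ≤ Real.exp (2 * θ) := by
      rw [hs, hq, div_mul_div_comm, div_le_iff₀ (by positivity), hexp2]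
      calc W (φ l i) j * W (x i) (t l + j)
          ≤ (W (x i) j * Real.exp θ) * (W (φ l i) (t l + j) * Real.exp θ) := by gcongr
        _ = _ := by ring
    have hs2 : 1 ≤ s * Real.exp (2 * θ) := by
      rw [hs, hq, div_mul_div_comm, div_mul_eq_mul_div, le_div_iff₀ (by positivity), hexp2]
      calc 1 * (W (φ l i) (t l + j) * W (x i) j)
          ≤ (W (x i) (t l + j) * Real.exp θ) * (W (φ l i) j * Real.exp θ) := by
            rw [one_mul]; gcongr
        _ = _ := by ring
    have hs3 : |s - 1| ≤ Real.exp (2 * θ) - 1 :=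
      abs_sub_one_le_of_le_of_one_le_mul (Real.one_le_exp (by positivity)) hs1 hs2
    have hdec : p (v i l j) * (q : ℂ) - y i j
        = (p (v i l j) - v i l j ^ m) * (q : ℂ) + y i j * ((s - 1 : ℝ) : ℂ) := by
      rw [hv, hs]
      push_cast
      ring
    rw [hdec]
    refine (norm_add_le _ _).trans ?_
    rw [norm_mul, norm_mul, Complex.norm_real, Complex.norm_real, Real.norm_of_nonneg hq0.le,
      Real.norm_eq_abs]
    have g1 := hpsmall l j hj
    have g2 : ‖v i l j‖ ^ m * q = ‖y i j‖ * s := by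
      rw [hvm, hs, mul_div_assoc, mul_assoc]
    have g3 := hY i j hj
    calc ‖p (v i l j) - v i l j ^ m‖ * q + ‖y i j‖ * |s - 1|
        ≤ Q * κ * ‖v i l j‖ ^ m * q + Y * (Real.exp (2 * θ) - 1) := by gcongr
      _ = Q * κ * (‖y i j‖ * s) + Y * (Real.exp (2 * θ) - 1) := by rw [mul_assoc, g2]
      _ ≤ Q * κ * (Y * 2) + Y * (Real.exp (2 * θ) - 1) := by
          have := hs1.trans hθ2
          gcongr
      _ ≤ δ₁ := by linarith
  · have hp0 : p 0 = 0 := by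
      have h1 := hp 0 (by simp)
      rw [zero_pow (by omega), norm_zero, zero_pow (by omega), mul_zero, sub_zero] at h1
      exact norm_le_zero_iff.1 h1
    refine lt_of_le_of_lt ?_ (hL₁ L hLL (3 * N - t l))
    have key : ∀ r ≥ J, a i (t l + r) ≠ 0 → L ≤ r ∧ ∃ l' j, j < J ∧ t l + r = t l' + j ∧
        t l' - t l ≤ r ∧ |φ l i - φ l' i| * (N : ℝ) ^ α
          ≤ D₃ / (6 * D₁) * ((t l' - t l : ℕ) : ℝ) ^ α := by
      intro r hr h
      obtain ⟨l', j, hj, hk⟩ := ha0 i (t l + r) (by omega) h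
      have hlt : t l < t l' := by omega
      have hne : l ≠ l' := fun h => by rw [h] at hlt; omega
      obtain ⟨h1, h2⟩ := hsep l l' hne hlt.le
      exact ⟨by omega, l', j, hj, hk, by omega, h2 i⟩
    have hterm : ∀ r ≥ J, t l + r ≤ 3 * N → a i (t l + r) ≠ 0 →
        ‖p (a i (t l + r))‖ * (W (x i) (t l + r) / W (x i) r)
          ≤ C₁ * Real.exp (-(D₃ / 2) * (r : ℝ) ^ α) := by
      intro r hr hrN h
      obtain ⟨hLr, l', j, hj, hk, hle, hdist⟩ := key r hr h
      have p1 := hW.pos _ hxi (t l + r)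
      have p2 := hW.pos _ hxi r
      have p3 := hW.pos _ (hφ₀ l' i) (t l + r)
      have g1 := hpsmall l' j hj
      have g2 : ‖p (v i l' j)‖ ≤ 2 * ‖v i l' j‖ ^ m := by
        have h1 : ‖p (v i l' j)‖ ≤ ‖p (v i l' j) - v i l' j ^ m‖ + ‖v i l' j ^ m‖ := by
          simpa using norm_add_le (p (v i l' j) - v i l' j ^ m) (v i l' j ^ m)
        rw [norm_pow] at h1
        have h2 : Q * κ * ‖v i l' j‖ ^ m ≤ 1 * ‖v i l' j‖ ^ m := by gcongr
        linarith
      have g3 : ‖p (a i (t l + r))‖ ≤ 2 * (Y * C₀) / W (φ l' i) (t l + r) := by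
        rw [hk, hav i l' j hj]
        refine g2.trans ?_
        rw [hvm, mul_div_assoc 2]
        have h1 := hyC i l' j hj
        have h3 := hW.pos _ (hφ₀ l' i) (t l' + j)
        gcongr
      have hexp : D₁ * ((t l + r : ℕ) : ℝ) ^ α * |x i - φ l' i| ≤ θ + D₃ / 2 * (r : ℝ) ^ α := by
        have h1 := hpow (t l + r) hrN
        have h2 := hl i
        have h3 : ((t l' - t l : ℕ) : ℝ) ^ α ≤ (r : ℝ) ^ α :=
          Real.rpow_le_rpow (by positivity) (by exact_mod_cast hle) hα₀.le
        calc D₁ * ((t l + r : ℕ) : ℝ) ^ α * |x i - φ l' i|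
            ≤ D₁ * (3 * (N : ℝ) ^ α) * (|x i - φ l i| + |φ l i - φ l' i|) := by
              gcongr
              exact abs_sub_le _ _ _
          _ = D₁ * 3 * (|x i - φ l i| * (N : ℝ) ^ α)
              + D₁ * 3 * (|φ l i - φ l' i| * (N : ℝ) ^ α) := by ring
          _ ≤ D₁ * 3 * τ + D₁ * 3 * (D₃ / (6 * D₁) * (r : ℝ) ^ α) := by
              have := hdist.trans (mul_le_mul_of_nonneg_left h3
                (by positivity : 0 ≤ D₃ / (6 * D₁)))
              gcongr
          _ = θ + D₃ / 2 * (r : ℝ) ^ α := by rw [hτθ]; field_simp; ring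
      have e1 := (hW.le_mul_exp _ (by omega : N₀ ≤ t l + r) _ hxi _ (hφ₀ l' i)).trans
        (mul_le_mul_of_nonneg_left (Real.exp_le_exp.2 hexp) p3.le)
      have e2 := hW.exp_le r (by omega) _ hxi
      have hθ2' : Real.exp θ ≤ 2 := (Real.exp_le_exp.2 (by linarith)).trans hθ2
      calc ‖p (a i (t l + r))‖ * (W (x i) (t l + r) / W (x i) r)
          ≤ 2 * (Y * C₀) / W (φ l' i) (t l + r) *
            (W (φ l' i) (t l + r) * Real.exp (θ + D₃ / 2 * (r : ℝ) ^ α) /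
              (D₂ * Real.exp (D₃ * (r : ℝ) ^ α))) := by gcongr
        _ = 2 * (Y * C₀) / D₂ * (Real.exp (θ + D₃ / 2 * (r : ℝ) ^ α) /
              Real.exp (D₃ * (r : ℝ) ^ α)) := by field_simp
        _ = 2 * (Y * C₀) / D₂ * (Real.exp θ * Real.exp (-(D₃ / 2) * (r : ℝ) ^ α)) := by
            rw [← Real.exp_sub, ← Real.exp_add]
            congr 2
            ring
        _ ≤ 2 * (Y * C₀) / D₂ * (2 * Real.exp (-(D₃ / 2) * (r : ℝ) ^ α)) := by gcongr
        _ = _ := by rw [hC₁]; ring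
    have hC1pos : 0 < C₁ := by positivity
    rw [← Finset.sum_subset (Finset.Ico_subset_Ico_left hLJ)]
    · refine Finset.sum_le_sum fun r hr => ?_
      rw [Finset.mem_Ico] at hr
      by_cases h : a i (t l + r) = 0
      · rw [h, hp0, norm_zero, zero_mul]; positivity
      · exact hterm r (by omega) (by omega) h
    · intro r hr hr'
      rw [Finset.mem_Ico] at hr hr'
      by_cases h : a i (t l + r) = 0
      · rw [h, hp0, norm_zero, zero_mul]
      · have := (key r hr.1 h).1
        omega

/-! ### Polynomials without constant term acting on a sequence algebra -/

section Polynomials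

variable {X : Type*} [NonUnitalCommRing X] [Module ℂ X]

/-- The power `x ^ (k + 1)` in a non-unital ring. -/
def powSucc (x : X) : ℕ → X
  | 0 => x
  | k + 1 => powSucc x k * x

/-- The polynomial without constant term `∑ k < M, c k x ^ (k + 1)` at the point `x`. -/
def polyApply {M : ℕ} (c : Fin M → ℂ) (x : X) : X := ∑ k, c k • powSucc x k

/-- The scalar polynomial `z ↦ ∑ k < M, c k z ^ (k + 1)`. -/
def polyScalar {M : ℕ} (c : Fin M → ℂ) (z : ℂ) : ℂ := ∑ k, c k * z ^ ((k : ℕ) + 1)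

theorem polyScalar_zero {M : ℕ} (c : Fin M → ℂ) : polyScalar c 0 = 0 := by
  simp [polyScalar]

theorem coord_powSucc [SequenceAlgebra X] (x : X) (k n : ℕ) :
    SequenceAlgebra.coord (powSucc x k) n = SequenceAlgebra.coord x n ^ (k + 1) := by
  induction k with
  | zero => simp [powSucc]
  | succ k ih => rw [powSucc, SequenceAlgebra.coord_mul, ih, pow_succ _ (k + 1)]

theorem coord_polyApply [SequenceAlgebra X] {M : ℕ} (c : Fin M → ℂ) (x : X) (n : ℕ) :
    SequenceAlgebra.coord (polyApply c x) n = polyScalar c (SequenceAlgebra.coord x n) := by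
  simp [polyApply, polyScalar, coord_powSucc]

/-- The polynomials `z ^ (k₀ + 1) + ∑ k₀ < k < M, c k z ^ (k + 1)` with coefficients bounded by
`C`, encoded by their coefficients. -/
def normalizedCoeffs {M : ℕ} (k₀ : Fin M) (C : ℝ) : Set (Fin M → ℂ) :=
  {c | c k₀ = 1 ∧ (∀ k < k₀, c k = 0) ∧ ∀ k, ‖c k‖ ≤ C}

theorem isCompact_normalizedCoeffs {M : ℕ} (k₀ : Fin M) (C : ℝ) :
    IsCompact (normalizedCoeffs k₀ C) := by
  have h1 : IsCompact (Set.univ.pi fun _ : Fin M => Metric.closedBall (0 : ℂ) C) :=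
    isCompact_univ_pi fun _ => isCompact_closedBall _ _
  refine h1.of_isClosed_subset ?_ fun c hc k _ => by simpa using hc.2.2 k
  have e : normalizedCoeffs k₀ C =
      {c | c k₀ = 1} ∩ ((⋂ k, ⋂ _ : k < k₀, {c | c k = 0}) ∩ ⋂ k, {c | ‖c k‖ ≤ C}) := by
    ext c
    simp [normalizedCoeffs]
  rw [e]
  refine (isClosed_eq (continuous_apply _) continuous_const).inter (IsClosed.inter ?_ ?_)
  · exact isClosed_iInter fun k => isClosed_iInter fun _ =>
      isClosed_eq (continuous_apply _) continuous_const
  · exact isClosed_iInter fun k => isClosed_le (continuous_apply k).norm continuous_const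

theorem norm_polyScalar_sub_pow_le {M : ℕ} {k₀ : Fin M} {C : ℝ} {c : Fin M → ℂ}
    (hc : c ∈ normalizedCoeffs k₀ C) {z : ℂ} (hz : ‖z‖ ≤ 1) :
    ‖polyScalar c z - z ^ ((k₀ : ℕ) + 1)‖ ≤ M * C * ‖z‖ ^ ((k₀ : ℕ) + 1 + 1) := by
  obtain ⟨h1, h2, h3⟩ := hc
  have hC : 0 ≤ C := (norm_nonneg _).trans (h3 k₀)
  have e : polyScalar c z - z ^ ((k₀ : ℕ) + 1)
      = ∑ k ∈ Finset.univ.erase k₀, c k * z ^ ((k : ℕ) + 1) := by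
    rw [polyScalar, ← Finset.add_sum_erase _ _ (Finset.mem_univ k₀), h1]
    ring
  rw [e]
  refine (norm_sum_le_of_le _ (f := fun k : Fin M => c k * z ^ ((k : ℕ) + 1))
    (n := fun _ => C * ‖z‖ ^ ((k₀ : ℕ) + 1 + 1)) fun k hk => ?_).trans ?_
  · rcases lt_or_gt_of_ne (Finset.ne_of_mem_erase hk) with h | h
    · simp only [h2 k h, zero_mul, norm_zero]
      positivity
    · rw [norm_mul, norm_pow]
      have h4 : (k₀ : ℕ) + 1 + 1 ≤ k + 1 := by
        have : (k₀ : ℕ) < k := h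
        omega
      have h5 := pow_le_pow_of_le_one (norm_nonneg z) hz h4
      have h6 := h3 k
      gcongr
  · rw [Finset.sum_const, nsmul_eq_mul, mul_assoc]
    gcongr
    simp

end Polynomials

section NormedPolynomials

variable {X : Type*} [NonUnitalNormedCommRing X]

theorem continuous_powSucc (k : ℕ) : Continuous fun x : X => powSucc x k := by
  induction k with
  | zero => exact continuous_id
  | succ k ih => exact ih.mul continuous_id

theorem continuous_polyApply [NormedSpace ℂ X] (M : ℕ) :
    Continuous fun q : (Fin M → ℂ) × X => polyApply q.1 q.2 := by
  unfold polyApply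
  refine continuous_finsetSum _ fun k _ => ?_
  exact ((continuous_apply k).comp continuous_fst).smul ((continuous_powSucc k).comp continuous_snd)

end NormedPolynomials

/-! ### Finitely supported vectors and iterated shifts -/

section Vectors

variable {X : Type*} [NonUnitalNormedCommRing X] [NormedSpace ℂ X] [SequenceAlgebra X]

/-- `e` is the system of the unit vectors of a sequence space: they are of norm at most one and
span a dense subspace. -/
structure IsUnitVectorSystem (e : ℕ → X) : Prop where
  coord_apply : ∀ n k, SequenceAlgebra.coord (e n) k = if k = n then 1 else 0
  norm_le_one : ∀ n, ‖e n‖ ≤ 1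
  dense_span : Dense (Submodule.span ℂ (Set.range e) : Set X)

namespace IsUnitVectorSystem

variable {e : ℕ → X}

theorem coord_sum (he : IsUnitVectorSystem e) (s : Finset ℕ) (a : ℕ → ℂ) (k : ℕ) :
    SequenceAlgebra.coord (∑ n ∈ s, a n • e n) k = if k ∈ s then a k else 0 := by
  simp [he.coord_apply]

theorem norm_sum_le (he : IsUnitVectorSystem e) (s : Finset ℕ) (a : ℕ → ℂ) (f : ℕ → ℕ) :
    ‖∑ n ∈ s, a n • e (f n)‖ ≤ ∑ n ∈ s, ‖a n‖ := by
  refine norm_sum_le_of_le _ fun n _ => ?_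
  rw [norm_smul]
  exact mul_le_of_le_one_right (norm_nonneg _) (he.norm_le_one _)

theorem polyApply_sum (he : IsUnitVectorSystem e) {M : ℕ} (c : Fin M → ℂ) (s : Finset ℕ)
    (a : ℕ → ℂ) :
    polyApply c (∑ n ∈ s, a n • e n) = ∑ n ∈ s, polyScalar c (a n) • e n := by
  apply SequenceAlgebra.coord_injective
  funext k
  rw [coord_polyApply, he.coord_sum, he.coord_sum]
  split_ifs
  · rfl
  · exact polyScalar_zero c

theorem exists_dist_lt (he : IsUnitVectorSystem e) (x : X) {ε : ℝ} (hε : 0 < ε) :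
    ∃ (a : ℕ → ℂ) (J₀ : ℕ), (∀ k ≥ J₀, a k = 0) ∧ ∀ J ≥ J₀,
      dist x (∑ n ∈ Finset.range J, a n • e n) < ε := by
  obtain ⟨z, hz, hxz⟩ := Metric.dense_iff.1 he.dense_span x ε hε
  obtain ⟨f, hf⟩ := (Finsupp.mem_span_range_iff_exists_finsupp).1 hxz
  obtain ⟨J₀, hJ₀⟩ := f.support.exists_nat_subset_range
  have h0 : ∀ k ≥ J₀, f k = 0 := fun k hk => by
    by_contra h
    have := Finset.mem_range.1 (hJ₀ (Finsupp.mem_support_iff.2 h))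
    omega
  refine ⟨f, J₀, h0, fun J hJ => ?_⟩
  have h1 : ∑ n ∈ Finset.range J, f n • e n = z := by
    rw [← hf, Finsupp.sum]
    symm
    refine Finset.sum_subset (hJ₀.trans (Finset.range_subset_range.2 hJ)) fun n _ hn => ?_
    rw [Finsupp.notMem_support_iff.1 hn, zero_smul]
  rw [h1, dist_comm]
  exact hz

theorem separableSpace (he : IsUnitVectorSystem e) : TopologicalSpace.SeparableSpace X := by
  have h1 : TopologicalSpace.IsSeparable (Submodule.span ℂ (Set.range e) : Set X) :=
    (Set.countable_range e).isSeparable.span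
  have h2 := h1.closure
  rw [he.dense_span.closure_eq] at h2
  exact TopologicalSpace.isSeparable_univ_iff.1 h2

end IsUnitVectorSystem

theorem coord_iterate_backwardShift {w : ℕ → ℝ} (h : IsAdmissible X w) (n : ℕ) (x : X) (k : ℕ) :
    SequenceAlgebra.coord ((backwardShift X w)^[n] x) k =
      ((∏ i ∈ Finset.Icc 1 (n + k), w i) / (∏ i ∈ Finset.Icc 1 k, w i) : ℝ) *
        SequenceAlgebra.coord x (n + k) := by
  induction n generalizing x with
  | zero =>
    have h0 : ∏ i ∈ Finset.Icc 1 k, w i ≠ 0 :=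
      (Finset.prod_pos fun i hi => h.1 i (Finset.mem_Icc.1 hi).1).ne'
    simp [div_self h0]
  | succ n ih =>
    rw [Function.iterate_succ_apply, ih, coord_backwardShift h, ← mul_assoc]
    have h1 : n + 1 + k = n + k + 1 := by ring
    rw [h1, Finset.prod_Icc_succ_top (by omega)]
    push_cast
    ring

/-- The action of the powers of a weighted backward shift on a finitely supported vector. -/
theorem IsUnitVectorSystem.iterate_backwardShift_sum {e : ℕ → X} (he : IsUnitVectorSystem e)
    {w : ℕ → ℝ} (h : IsAdmissible X w) (n R : ℕ) (a : ℕ → ℂ) :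
    (backwardShift X w)^[n] (∑ k ∈ Finset.range R, a k • e k) =
      ∑ r ∈ Finset.range (R - n),
        (a (n + r) * ((∏ i ∈ Finset.Icc 1 (n + r), w i) / (∏ i ∈ Finset.Icc 1 r, w i) : ℝ)) •
          e r := by
  apply SequenceAlgebra.coord_injective
  funext k
  rw [coord_iterate_backwardShift h, he.coord_sum, he.coord_sum]
  have h1 : n + k ∈ Finset.range R ↔ k ∈ Finset.range (R - n) := by
    simp only [Finset.mem_range]
    omega
  by_cases hk : k ∈ Finset.range (R - n)
  · rw [if_pos hk, if_pos (h1.2 hk), mul_comm]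
  · rw [if_neg hk, if_neg (fun h => hk (h1.1 h)), mul_zero]

theorem iterate_productShift_apply {d : ℕ} (w : ℝ → ℕ → ℝ) (l : Fin d → ℝ) (n : ℕ)
    (x : Fin d → X) (i : Fin d) :
    (⇑(productShift X w l))^[n] x i = (backwardShift X (w (l i)))^[n] (x i) := by
  induction n generalizing x with
  | zero => rfl
  | succ n ih => rw [Function.iterate_succ_apply, ih, Function.iterate_succ_apply]; rfl

end Vectors

/-! ### Open dense sets of vectors -/

section Baire

variable {X : Type*} [NonUnitalNormedCommRing X] [NormedSpace ℂ X] [SequenceAlgebra X]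
  {I : Set ℝ} {w : ℝ → ℕ → ℝ} {d : ℕ}

/-- The vectors `x` such that, for all parameters `l ∈ K` and all polynomials with coefficients
in `Γ`, the orbit of the value at `x` of the polynomial visits `V`. -/
def visitingVectors (w : ℝ → ℕ → ℝ) (K : Set (Fin d → ℝ)) {M : ℕ} (Γ : Set (Fin M → ℂ))
    (V : Set (Fin d → X)) : Set (Fin d → X) :=
  {x | ∀ l ∈ K, ∀ c ∈ Γ, ∃ n ≥ 1,
    (⇑(productShift X w l))^[n] (fun i => polyApply c (x i)) ∈ V}

theorem continuousOn_iterate_backwardShift (hw : IsContinuousWeightFamily X I w) (n : ℕ) :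
    ContinuousOn (fun q : ℝ × X => (backwardShift X (w q.1))^[n] q.2) (I ×ˢ Set.univ) := by
  induction n with
  | zero => exact continuousOn_snd
  | succ n ih =>
    simp only [Function.iterate_succ_apply']
    exact hw.continuousOn_shift.comp (continuousOn_fst.prodMk ih)
      fun q hq => ⟨hq.1, Set.mem_univ _⟩

theorem isOpen_visitingVectors (hw : IsContinuousWeightFamily X I w) {K : Set (Fin d → ℝ)}
    (hK : IsCompact K) (hKI : ∀ l ∈ K, ∀ i, l i ∈ I) {M : ℕ} {Γ : Set (Fin M → ℂ)}
    (hΓ : IsCompact Γ) {V : Set (Fin d → X)} (hV : IsOpen V) :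
    IsOpen (visitingVectors w K Γ V) := by
  have hcont : ∀ n, ContinuousOn (fun q : (Fin d → X) × ((Fin d → ℝ) × (Fin M → ℂ)) =>
      (⇑(productShift X w q.2.1))^[n] (fun i => polyApply q.2.2 (q.1 i)))
      (Set.univ ×ˢ (K ×ˢ Γ)) := by
    intro n
    refine continuousOn_pi.2 fun i => ?_
    simp only [iterate_productShift_apply]
    have h1 : Continuous fun q : (Fin d → X) × ((Fin d → ℝ) × (Fin M → ℂ)) =>
        (q.2.1 i, polyApply q.2.2 (q.1 i)) := by
      have h2 : Continuous fun q : (Fin d → X) × ((Fin d → ℝ) × (Fin M → ℂ)) =>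
        (q.2.2, q.1 i) := by fun_prop
      exact Continuous.prodMk (by fun_prop) ((continuous_polyApply M).comp h2)
    exact (continuousOn_iterate_backwardShift hw n).comp h1.continuousOn
      fun q hq => ⟨hKI _ hq.2.1 i, Set.mem_univ _⟩
  rw [isOpen_iff_eventually]
  intro x hx
  have h := (hK.prod hΓ).eventually_forall_of_forall_eventually (x₀ := x)
    (P := fun x q => q ∈ K ×ˢ Γ → ∃ n ≥ 1,
      (⇑(productShift X w q.1))^[n] (fun i => polyApply q.2 (x i)) ∈ V) fun q hq => by
    obtain ⟨n, hn, hnV⟩ := hx q.1 hq.1 q.2 hq.2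
    have h1 := (hcont n (x, q) ⟨Set.mem_univ _, hq⟩).eventually (hV.mem_nhds hnV)
    rw [eventually_nhdsWithin_iff] at h1
    filter_upwards [h1] with z hz hzK
    exact ⟨n, hn, hz ⟨Set.mem_univ _, hzK⟩⟩
  filter_upwards [h] with z hz l hl c hc
  exact hz (l, c) ⟨hl, hc⟩ ⟨hl, hc⟩

theorem dense_visitingVectors {e : ℕ → X} (he : IsUnitVectorSystem e) {K : Set (Fin d → ℝ)}
    (hw : ∀ l ∈ K, ∀ i, IsAdmissible X (w (l i)))
    (hK : HasApproximatingCoordinates (fun a n => ∏ i ∈ Finset.Icc 1 n, w a i) K) {M : ℕ}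
    (k₀ : Fin M) {C : ℝ} (hC : 0 ≤ C) {V : Set (Fin d → X)} (hV : IsOpen V) (hVne : V.Nonempty) :
    Dense (visitingVectors w K (normalizedCoeffs k₀ C) V) := by
  rw [Metric.dense_iff]
  intro x₀ r hr
  obtain ⟨y₀, hy₀⟩ := hVne
  obtain ⟨r', hr', hball⟩ := Metric.isOpen_iff.1 hV y₀ hy₀
  set δ : ℝ := min r r' with hδ
  have hδ0 : 0 < δ := lt_min hr hr'
  choose u J₁ _ hu using fun i => he.exists_dist_lt (x₀ i) (half_pos hδ0)
  choose y J₂ _ hy using fun i => he.exists_dist_lt (y₀ i) (half_pos hδ0)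
  set J : ℕ := ∑ i, (J₁ i + J₂ i) with hJ
  have hJi : ∀ i, J₁ i + J₂ i ≤ J := fun i =>
    Finset.single_le_sum (f := fun i => J₁ i + J₂ i) (fun _ _ => Nat.zero_le _) (Finset.mem_univ i)
  obtain ⟨R, a, hJR, hau, ha, hreach⟩ := hK u y J (δ / 4) (by positivity) (k₀ + 1) (by omega)
    (M * C) (by positivity)
  refine ⟨fun i => ∑ k ∈ Finset.range R, a i k • e k, ?_, ?_⟩
  · rw [Metric.mem_ball, dist_pi_lt_iff hr]
    intro i
    have h1 := hu i J (by have := hJi i; omega)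
    have h2 : ∑ k ∈ Finset.range R, a i k • e k
        = ∑ k ∈ Finset.range J, u i k • e k + ∑ k ∈ Finset.Ico J R, a i k • e k := by
      rw [← Finset.sum_range_add_sum_Ico _ hJR]
      congr 1
      exact Finset.sum_congr rfl fun k hk => by rw [hau i k (Finset.mem_range.1 hk)]
    have h3 := (he.norm_sum_le (Finset.Ico J R) (a i) id).trans_lt (ha i)
    simp only [id] at h3
    rw [h2, dist_comm]
    have h4 := dist_triangle (x₀ i) (∑ k ∈ Finset.range J, u i k • e k)
      (∑ k ∈ Finset.range J, u i k • e k + ∑ k ∈ Finset.Ico J R, a i k • e k)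
    rw [dist_self_add_right] at h4
    have h5 := min_le_left r r'
    linarith
  · intro l hl c hc
    obtain ⟨n, hn, hnR, hp⟩ := hreach l hl
    refine ⟨n, hn, hball ?_⟩
    rw [Metric.mem_ball, dist_pi_lt_iff hr']
    intro i
    obtain ⟨g1, g2⟩ := hp (polyScalar c) (fun z hz => norm_polyScalar_sub_pow_le hc hz) i
    rw [iterate_productShift_apply, he.polyApply_sum, he.iterate_backwardShift_sum (hw l hl i)]
    have h1 := hy i J (by have := hJi i; omega)
    set b : ℕ → ℂ := fun r => polyScalar c (a i (n + r)) *
      ((∏ j ∈ Finset.Icc 1 (n + r), w (l i) j) / (∏ j ∈ Finset.Icc 1 r, w (l i) j) : ℝ) with hb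
    have h2 : ∑ k ∈ Finset.range (R - n), b k • e k
        = ∑ k ∈ Finset.range J, y i k • e k + (∑ k ∈ Finset.range J, (b k - y i k) • e k
          + ∑ k ∈ Finset.Ico J (R - n), b k • e k) := by
      rw [← Finset.sum_range_add_sum_Ico _ (by omega : J ≤ R - n), ← add_assoc,
        ← Finset.sum_add_distrib]
      congr 1
      exact Finset.sum_congr rfl fun k _ => by rw [← add_smul]; congr 1; ring
    have h3 := (he.norm_sum_le (Finset.range J) (fun k => b k - y i k) id).trans_lt g1
    have hbn : ∀ r, ‖b r‖ = ‖polyScalar c (a i (n + r))‖ *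
        ((∏ j ∈ Finset.Icc 1 (n + r), w (l i) j) / (∏ j ∈ Finset.Icc 1 r, w (l i) j)) := by
      intro r
      have hpos : ∀ k, 0 < ∏ j ∈ Finset.Icc 1 k, w (l i) j := fun k =>
        Finset.prod_pos fun j hj => (hw l hl i).1 j (Finset.mem_Icc.1 hj).1
      have h6 := hpos (n + r)
      have h7 := hpos r
      rw [hb, norm_mul, Complex.norm_real, Real.norm_of_nonneg (by positivity)]
    have h4 := he.norm_sum_le (Finset.Ico J (R - n)) b id
    rw [Finset.sum_congr rfl fun r _ => hbn r] at h4
    replace h4 := h4.trans_lt g2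
    simp only [id] at h3 h4
    rw [h2, dist_comm]
    have h5 := dist_triangle (y₀ i) (∑ k ∈ Finset.range J, y i k • e k)
      (∑ k ∈ Finset.range J, y i k • e k + (∑ k ∈ Finset.range J, (b k - y i k) • e k
          + ∑ k ∈ Finset.Ico J (R - n), b k • e k))
    rw [dist_self_add_right] at h5
    have h6 := norm_add_le (∑ k ∈ Finset.range J, (b k - y i k) • e k)
      (∑ k ∈ Finset.Ico J (R - n), b k • e k)
    have h7 := min_le_right r r'
    linarith

/-! ### The common hypercyclic algebra -/

theorem IsContinuousWeightFamily.isGrowingProduct (hw : IsContinuousWeightFamily X I w) {K₀ : Set ℝ}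
    (hK₀ : K₀ ⊆ I) {α D₁ D₂ D₃ : ℝ} {N : ℕ}
    (h : ∀ n ≥ N, (∀ a ∈ K₀, ∀ b ∈ K₀,
      |∑ i ∈ Finset.Icc 1 n, Real.log (w a i) - ∑ i ∈ Finset.Icc 1 n, Real.log (w b i)|
        ≤ D₁ * (n : ℝ) ^ α * |a - b|) ∧
      ∀ a ∈ K₀, D₂ * Real.exp (D₃ * (n : ℝ) ^ α) ≤ ∏ i ∈ Finset.Icc 1 n, w a i) :
    IsGrowingProduct α K₀ (fun a n => ∏ i ∈ Finset.Icc 1 n, w a i) D₁ D₂ D₃ N := by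
  have hpos : ∀ a ∈ K₀, ∀ i, 1 ≤ i → 0 < w a i := fun a ha => (hw.admissible a (hK₀ ha)).1
  refine ⟨fun a ha n => Finset.prod_pos fun i hi => hpos a ha i (Finset.mem_Icc.1 hi).1,
    fun n => continuousOn_finsetProd _ fun i hi =>
      (hw.continuousOn_weight i (Finset.mem_Icc.1 hi).1).mono hK₀, fun n hn a ha b hb => ?_,
    fun n hn => (h n hn).2⟩
  have e : ∀ a ∈ K₀, ∏ i ∈ Finset.Icc 1 n, w a i
      = Real.exp (∑ i ∈ Finset.Icc 1 n, Real.log (w a i)) := by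
    intro a ha
    rw [Real.exp_sum]
    exact Finset.prod_congr rfl fun i hi =>
      (Real.exp_log (hpos a ha i (Finset.mem_Icc.1 hi).1)).symm
  simp only [e a ha, e b hb, ← Real.exp_add]
  have := (le_abs_self _).trans ((h n hn).1 a ha b hb)
  exact Real.exp_le_exp.2 (by linarith)

/-- The parameter set is a countable union of compact sets that are small enough for
`exists_coordinates` to apply. -/
theorem exists_countable_cover (hd : 1 ≤ d) {α : ℝ} (hα₀ : 0 < α) (hα₁ : α < 1 / (d : ℝ))
    (hI : IsSigmaCompact I) (hw : IsContinuousWeightFamily X I w)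
    (hg : PowerGrowthCondition α I w) :
    ∃ K : ℕ × (Fin d → ℤ) → Set (Fin d → ℝ),
      (∀ q, IsCompact (K q) ∧ (∀ l ∈ K q, ∀ i, l i ∈ I) ∧
        HasApproximatingCoordinates (fun a n => ∏ i ∈ Finset.Icc 1 n, w a i) (K q)) ∧
      ∀ l : Fin d → ℝ, (∀ i, l i ∈ I) → ∃ q, l ∈ K q := by
  obtain ⟨S, hS, hSI⟩ := hI
  have hTc : ∀ j, IsCompact (Set.accumulate S j) := isCompact_accumulate hS
  have hTI : ∀ j, Set.accumulate S j ⊆ I := fun j => by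
    rw [← hSI]
    exact Set.accumulate_subset_iUnion j
  choose D₁ hD₁ D₂ hD₂ D₃ hD₃ N hN using fun j => hg _ (hTI j) (hTc j)
  choose ρ hρ hcoord using fun j => exists_coordinates hd hα₀ hα₁ (hD₁ j) (hD₂ j) (hD₃ j)
  refine ⟨fun q => {l | (∀ i, l i ∈ Set.accumulate S q.1) ∧
    ∀ i, q.2 i * ρ q.1 ≤ l i ∧ l i ≤ q.2 i * ρ q.1 + ρ q.1}, fun q => ⟨?_, ?_, ?_⟩, fun l hl => ?_⟩
  · have h1 : IsCompact (Set.univ.pi fun _ : Fin d => Set.accumulate S q.1) :=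
      isCompact_univ_pi fun _ => hTc q.1
    have h2 : IsClosed {l : Fin d → ℝ |
        ∀ i, q.2 i * ρ q.1 ≤ l i ∧ l i ≤ q.2 i * ρ q.1 + ρ q.1} := by
      simp only [Set.ofPred_forall]
      exact isClosed_iInter fun i => (isClosed_le continuous_const (continuous_apply i)).inter
        (isClosed_le (continuous_apply i) continuous_const)
    convert h1.inter_right h2 using 1
    ext l
    simp
  · exact fun l hl i => hTI _ (hl.1 i)
  · exact hcoord q.1 _ _ (N q.1) (hTc q.1) (hw.isGrowingProduct (hTI q.1) (hN q.1))
      (fun i => q.2 i * ρ q.1) _ (fun x hx => hx.1) fun x hx => hx.2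
  · have h1 : ∀ i, ∃ j, l i ∈ S j := fun i => by
      have := hl i
      rw [← hSI] at this
      exact Set.mem_iUnion.1 this
    choose j hj using h1
    have hle : ∀ i, j i ≤ ∑ i, j i := fun i =>
      Finset.single_le_sum (f := j) (fun _ _ => Nat.zero_le _) (Finset.mem_univ i)
    refine ⟨(∑ i, j i, fun i => ⌊l i / ρ (∑ i, j i)⌋), fun i =>
      Set.mem_accumulate.2 ⟨j i, hle i, hj i⟩, fun i => ?_⟩
    have hρ' := hρ (∑ i, j i)
    have h2 := Int.floor_le (l i / ρ (∑ i, j i))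
    have h3 := Int.lt_floor_add_one (l i / ρ (∑ i, j i))
    rw [le_div_iff₀ hρ'] at h2
    rw [div_lt_iff₀ hρ'] at h3
    constructor <;> simp only <;> linarith

/-- The values at `x` of the polynomials without constant term. -/
def polynomialAlgebra (x : Fin d → X) : NonUnitalSubalgebra ℂ (Fin d → X) where
  carrier := {z | ∃ Q : Polynomial ℂ, Q.coeff 0 = 0 ∧
    ∀ i n, SequenceAlgebra.coord (z i) n = Q.eval (SequenceAlgebra.coord (x i) n)}
  add_mem' := by
    rintro z z' ⟨Q, h0, h⟩ ⟨Q', h0', h'⟩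
    exact ⟨Q + Q', by simp [h0, h0'], fun i n => by simp [h, h']⟩
  zero_mem' := ⟨0, by simp, fun i n => by simp⟩
  mul_mem' := by
    rintro z z' ⟨Q, h0, h⟩ ⟨Q', h0', h'⟩
    exact ⟨Q * Q', by simp [h0], fun i n => by
      rw [Pi.mul_apply, SequenceAlgebra.coord_mul, h, h', Polynomial.eval_mul]⟩
  smul_mem' := by
    rintro a z ⟨Q, h0, h⟩
    exact ⟨Polynomial.C a * Q, by simp [h0], fun i n => by simp [h]⟩

theorem self_mem_polynomialAlgebra (x : Fin d → X) : x ∈ polynomialAlgebra x :=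
  ⟨Polynomial.X, by simp, fun i n => by simp⟩

/-- Up to a non-zero scalar factor, every non-zero element of the algebra is the value of a
polynomial whose lowest coefficient is `1`. -/
theorem exists_eq_smul_polyApply {x z : Fin d → X} (hz : z ∈ polynomialAlgebra x) (hz0 : z ≠ 0) :
    ∃ (a : ℂ) (M : ℕ) (k₀ : Fin M) (C : ℕ), a ≠ 0 ∧ ∃ c ∈ normalizedCoeffs k₀ (C : ℝ),
      z = a • fun i => polyApply c (x i) := by
  obtain ⟨Q, h0, h⟩ := hz
  have hQ : Q ≠ 0 := by
    rintro rfl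
    refine hz0 (funext fun i => SequenceAlgebra.coord_injective (funext fun n => ?_))
    rw [h]
    simp
  have ha : Q.trailingCoeff ≠ 0 := Polynomial.trailingCoeff_nonzero_iff_nonzero.2 hQ
  have htd : Q.natTrailingDegree ≠ 0 := fun h1 => ha (by rw [Polynomial.trailingCoeff, h1, h0])
  have htd' := Polynomial.natTrailingDegree_le_natDegree Q
  set c : Fin Q.natDegree → ℂ := fun k => Q.coeff (k + 1) / Q.trailingCoeff with hc
  obtain ⟨C, hC⟩ := exists_nat_ge (∑ k, ‖c k‖)
  refine ⟨Q.trailingCoeff, Q.natDegree, ⟨Q.natTrailingDegree - 1, by omega⟩, C, ha, c,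
    ⟨?_, fun k hk => ?_, fun k => ?_⟩, ?_⟩
  · have e : Q.natTrailingDegree - 1 + 1 = Q.natTrailingDegree := by omega
    simp only [hc, e]
    exact div_self ha
  · have hk' : (k : ℕ) < Q.natTrailingDegree - 1 := hk
    simp only [hc]
    rw [Polynomial.coeff_eq_zero_of_lt_natTrailingDegree (by omega), zero_div]
  · exact (Finset.single_le_sum (f := fun k => ‖c k‖) (fun _ _ => norm_nonneg _)
      (Finset.mem_univ k)).trans hC
  · refine funext fun i => SequenceAlgebra.coord_injective (funext fun n => ?_)
    rw [h, Pi.smul_apply, map_smul, Pi.smul_apply, coord_polyApply, polyScalar,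
      Polynomial.eval_eq_sum_range, Finset.sum_range_succ', h0, zero_mul, add_zero, smul_eq_mul,
      Finset.mul_sum, ← Fin.sum_univ_eq_sum_range
        (fun k => Q.coeff (k + 1) * SequenceAlgebra.coord (x i) n ^ (k + 1))]
    refine Finset.sum_congr rfl fun k _ => ?_
    rw [hc, ← mul_assoc, mul_div_cancel₀ _ ha]

theorem hasCommonHypercyclicAlgebra_productShift [CompleteSpace X] {e : ℕ → X}
    (he : IsUnitVectorSystem e) (hd : 1 ≤ d) {α : ℝ} (hα₀ : 0 < α) (hα₁ : α < 1 / (d : ℝ))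
    (hI : IsSigmaCompact I) (hw : IsContinuousWeightFamily X I w)
    (hg : PowerGrowthCondition α I w) :
    HasCommonHypercyclicAlgebra {l : Fin d → ℝ | ∀ i, l i ∈ I} (productShift X w) := by
  obtain ⟨K, hK, hcover⟩ := exists_countable_cover hd hα₀ hα₁ hI hw hg
  have := he.separableSpace
  have := UniformSpace.secondCountable_of_separable X
  obtain ⟨b, hbc, hb0, hb⟩ := TopologicalSpace.exists_countable_basis (Fin d → X)
  have := hbc.to_subtype
  have hdense : Dense (⋂ q : b × (ℕ × (Fin d → ℤ)) × (Σ M, Fin M) × ℕ,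
      visitingVectors w (K q.2.1) (normalizedCoeffs q.2.2.1.2 (q.2.2.2 : ℝ)) q.1.1) := by
    refine dense_iInter_of_isOpen (fun q => ?_) fun q => ?_
    · exact isOpen_visitingVectors hw (hK _).1 (hK _).2.1 (isCompact_normalizedCoeffs _ _)
        (hb.isOpen q.1.2)
    · exact dense_visitingVectors he (fun l hl i => hw.admissible _ ((hK _).2.1 l hl i)) (hK _).2.2
        _ (Nat.cast_nonneg _) (hb.isOpen q.1.2)
        (Set.nonempty_iff_ne_empty.2 fun h => hb0 (h ▸ q.1.2))
  have he0 : (fun _ => e 0 : Fin d → X) ≠ 0 := by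
    intro h
    have h1 := he.coord_apply 0 0
    rw [show e 0 = 0 from congrFun h ⟨0, hd⟩] at h1
    simp at h1
  obtain ⟨x, hx0, hx⟩ := hdense.inter_open_nonempty {0}ᶜ isOpen_compl_singleton ⟨_, he0⟩
  rw [Set.mem_iInter] at hx
  refine ⟨polynomialAlgebra x, ⟨x, self_mem_polynomialAlgebra x, hx0⟩, fun z hz hz0 l hl => ?_⟩
  obtain ⟨a, M, k₀, C, ha, c, hc, rfl⟩ := exists_eq_smul_polyApply hz hz0
  obtain ⟨q, hq⟩ := hcover l hl
  rw [IsHypercyclicVector, dense_iff_inter_open]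
  rintro U hU ⟨y, hy⟩
  obtain ⟨V, hVb, -, hVU⟩ := hb.exists_subset_of_mem_open (a := a⁻¹ • y)
    (u := (fun y => a • y) ⁻¹' U) (by simpa [smul_inv_smul₀ ha] using hy)
    (hU.preimage (continuous_const_smul a))
  obtain ⟨n, hn, hnV⟩ := hx (⟨V, hVb⟩, q, ⟨M, k₀⟩, C) l hq c hc
  refine ⟨_, hVU hnV, n, hn, ?_⟩
  have hcomm : Function.Commute (⇑(productShift X w l)) fun y => a • y :=
    fun y => map_smul _ a y
  exact hcomm.iterate_left n _

end Baire

/-! ### The spaces `ℓ_p` and `c₀` -/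

section Ellp

variable {p : ℝ≥0∞} [Fact (1 ≤ p)]

theorem ellp_sum_rpow_le (hp : p ≠ ∞) {f : ℕ → ℕ} (hf : Function.Injective f)
    (x : lp (fun _ : ℕ => ℂ) p) {z : ℕ → ℂ} {C : ℝ} (hC : 0 ≤ C)
    (h : ∀ n, ‖z n‖ ≤ C * ‖x (f n)‖) (s : Finset ℕ) :
    ∑ n ∈ s, ‖z n‖ ^ p.toReal ≤ (C * ‖x‖) ^ p.toReal := by
  have hp0 : 0 < p.toReal := ENNReal.toReal_pos (zero_lt_one.trans_le Fact.out).ne' hp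
  calc ∑ n ∈ s, ‖z n‖ ^ p.toReal ≤ ∑ n ∈ s, C ^ p.toReal * ‖x (f n)‖ ^ p.toReal := by
        refine Finset.sum_le_sum fun n _ => ?_
        rw [← Real.mul_rpow hC (norm_nonneg _)]
        exact Real.rpow_le_rpow (norm_nonneg _) (h n) hp0.le
    _ = C ^ p.toReal * ∑ k ∈ s.map ⟨f, hf⟩, ‖x k‖ ^ p.toReal := by
        rw [Finset.sum_map, Finset.mul_sum]
        rfl
    _ ≤ C ^ p.toReal * ‖x‖ ^ p.toReal := by
        gcongr
        exact lp.sum_rpow_le_norm_rpow hp0 x _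
    _ = (C * ‖x‖) ^ p.toReal := (Real.mul_rpow hC (norm_nonneg _)).symm

theorem ellp_norm_le (hp : p ≠ ∞) {f : ℕ → ℕ} (hf : Function.Injective f)
    (x z : lp (fun _ : ℕ => ℂ) p) {C : ℝ} (hC : 0 ≤ C) (h : ∀ n, ‖z n‖ ≤ C * ‖x (f n)‖) :
    ‖z‖ ≤ C * ‖x‖ :=
  lp.norm_le_of_forall_sum_le (ENNReal.toReal_pos (zero_lt_one.trans_le Fact.out).ne' hp)
    (by positivity) (ellp_sum_rpow_le hp hf x hC h)

/-- The space `ℓ_p`, `1 ≤ p < ∞`, is a normed ring for the coordinatewise product. -/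
@[reducible]
noncomputable def ellpNonUnitalNormedCommRing (p : ℝ≥0∞) [Fact (1 ≤ p)] (hp : p ≠ ∞) :
    NonUnitalNormedCommRing (lp (fun _ : ℕ => ℂ) p) :=
  { ellpNonUnitalCommRing p, (inferInstance : NormedAddCommGroup (lp (fun _ : ℕ => ℂ) p)) with
    norm_mul_le := fun x y => by
      rw [mul_comm ‖x‖]
      refine ellp_norm_le hp Function.injective_id x (x * y) (norm_nonneg y) fun n => ?_
      change ‖x n * y n‖ ≤ _
      rw [norm_mul, mul_comm]
      gcongr
      · exact lp.norm_apply_le_norm (zero_lt_one.trans_le Fact.out).ne' y n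
      · exact le_rfl }

theorem ellp_exists_isBackwardShift (hp : p ≠ ∞) (w : ℕ → ℝ) {C : ℝ} (hw : ∀ n, |w n| ≤ C) :
    ∃ T, IsBackwardShift (lp (fun _ : ℕ => ℂ) p) w T := by
  have hC : 0 ≤ C := (abs_nonneg _).trans (hw 0)
  have h (x : lp (fun _ : ℕ => ℂ) p) (n : ℕ) :
      ‖(w (n + 1) : ℂ) * x (n + 1)‖ ≤ C * ‖x (Nat.succ n)‖ := by
    rw [norm_mul, Complex.norm_real, Real.norm_eq_abs]
    gcongr
    exact hw _
  refine ⟨LinearMap.mkContinuous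
    { toFun := fun x => ⟨fun n => (w (n + 1) : ℂ) * x (n + 1),
        memℓp_gen' (ellp_sum_rpow_le hp Nat.succ_injective x hC (h x))⟩
      map_add' := fun x y => lp.ext (funext fun n => mul_add _ _ _)
      map_smul' := fun c x => lp.ext (funext fun n => mul_left_comm _ _ _) } C
    fun x => ellp_norm_le hp Nat.succ_injective x _ hC (h x), fun x n => rfl⟩

theorem ellp_norm_single_one (n : ℕ) : ‖(lp.single p n 1 : lp (fun _ : ℕ => ℂ) p)‖ = 1 := by
  rw [lp.norm_single (zero_lt_one.trans_le Fact.out), norm_one]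

theorem ellp_dense_span_single (hp : p ≠ ∞) :
    Dense (Submodule.span ℂ
      (Set.range fun n => (lp.single p n 1 : lp (fun _ : ℕ => ℂ) p)) :
        Set (lp (fun _ : ℕ => ℂ) p)) := by
  refine fun x => mem_closure_of_tendsto (lp.hasSum_single hp x)
    (Filter.Eventually.of_forall fun s => Submodule.sum_mem _ fun n _ => ?_)
  have h : lp.single p n (x n) = x n • (lp.single p n 1 : lp (fun _ : ℕ => ℂ) p) := by
    rw [← lp.single_smul, smul_eq_mul, mul_one]
  rw [h]
  exact Submodule.smul_mem _ _ (Submodule.subset_span ⟨n, rfl⟩)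

theorem ellp_isUnitVectorSystem (hp : p ≠ ∞) :
    letI := ellpNonUnitalNormedCommRing p hp
    IsUnitVectorSystem fun n => (lp.single p n 1 : lp (fun _ : ℕ => ℂ) p) := by
  let _ := ellpNonUnitalNormedCommRing p hp
  refine ⟨fun n k => ?_, fun n => (ellp_norm_single_one n).le, ellp_dense_span_single hp⟩
  change (lp.single p n 1 : lp (fun _ : ℕ => ℂ) p) k = _
  rw [lp.single_apply, Pi.single_apply]

end Ellp

section CZero

theorem cZero_norm_le {x : C₀(ℕ, ℂ)} {C : ℝ} (hC : 0 ≤ C) (h : ∀ n, ‖x n‖ ≤ C) : ‖x‖ ≤ C := by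
  rw [← ZeroAtInftyContinuousMap.norm_toBCF_eq_norm]
  exact (BoundedContinuousFunction.norm_le hC).2 h

theorem cZero_norm_apply_le (x : C₀(ℕ, ℂ)) (n : ℕ) : ‖x n‖ ≤ ‖x‖ := by
  rw [← ZeroAtInftyContinuousMap.norm_toBCF_eq_norm]
  exact x.toBCF.norm_coe_le_norm n

theorem cZero_tendsto (x : C₀(ℕ, ℂ)) : Filter.Tendsto x Filter.atTop (nhds 0) := by
  have h := x.zero_at_infty'
  rwa [Filter.cocompact_eq_cofinite, Nat.cofinite_eq_atTop] at h

/-- The element of `c₀` with given coordinates. -/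
def cZeroMk (x : ℕ → ℂ) (h : Filter.Tendsto x Filter.atTop (nhds 0)) : C₀(ℕ, ℂ) where
  toFun := x
  continuous_toFun := continuous_of_discreteTopology
  zero_at_infty' := by rwa [Filter.cocompact_eq_cofinite, Nat.cofinite_eq_atTop]

theorem cZero_exists_isBackwardShift (w : ℕ → ℝ) {C : ℝ} (hw : ∀ n, |w n| ≤ C) :
    ∃ T, IsBackwardShift C₀(ℕ, ℂ) w T := by
  have hC : 0 ≤ C := (abs_nonneg _).trans (hw 0)
  have h (x : C₀(ℕ, ℂ)) (n : ℕ) : ‖(w (n + 1) : ℂ) * x (n + 1)‖ ≤ C * ‖x (n + 1)‖ := by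
    rw [norm_mul, Complex.norm_real, Real.norm_eq_abs]
    gcongr
    exact hw _
  have ht (x : C₀(ℕ, ℂ)) :
      Filter.Tendsto (fun n => (w (n + 1) : ℂ) * x (n + 1)) Filter.atTop (nhds 0) := by
    refine squeeze_zero_norm (h x) ?_
    have := ((cZero_tendsto x).comp (Filter.tendsto_add_atTop_nat 1)).norm.const_mul C
    simpa using this
  refine ⟨LinearMap.mkContinuous
    { toFun := fun x => cZeroMk _ (ht x)
      map_add' := fun x y => ZeroAtInftyContinuousMap.ext fun n => mul_add _ _ _
      map_smul' := fun c x => ZeroAtInftyContinuousMap.ext fun n => mul_left_comm _ _ _ } C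
    fun x => cZero_norm_le (by positivity) fun n => (h x n).trans ?_, fun x n => rfl⟩
  gcongr
  exact cZero_norm_apply_le x _

theorem cZero_exists_isUnitVectorSystem : ∃ e : ℕ → C₀(ℕ, ℂ), IsUnitVectorSystem e := by
  have ht (n : ℕ) :
      Filter.Tendsto (fun k => if k = n then (1 : ℂ) else 0) Filter.atTop (nhds 0) :=
    tendsto_const_nhds.congr' ((Filter.eventually_gt_atTop n).mono fun k hk =>
      (if_neg hk.ne').symm)
  let e : ℕ → C₀(ℕ, ℂ) := fun n => cZeroMk _ (ht n)
  have he : ∀ n k, e n k = if k = n then 1 else 0 := fun n k => rfl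
  refine ⟨e, he, fun n => cZero_norm_le zero_le_one fun k => ?_,
    Metric.dense_iff.2 fun x r hr => ?_⟩
  · rw [he]
    split_ifs <;> simp
  · obtain ⟨J, hJ⟩ := Filter.eventually_atTop.1
      ((cZero_tendsto x).norm.eventually (gt_mem_nhds
        (by simpa using half_pos hr : ‖(0 : ℂ)‖ < r / 2)))
    refine ⟨∑ n ∈ Finset.range J, x n • e n, ?_, Submodule.sum_mem _ fun n _ =>
      Submodule.smul_mem _ _ (Submodule.subset_span ⟨n, rfl⟩)⟩
    rw [Metric.mem_ball, dist_eq_norm]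
    refine (cZero_norm_le (half_pos hr).le fun k => ?_).trans_lt (half_lt_self hr)
    have h1 : (∑ n ∈ Finset.range J, x n • e n) k = if k ∈ Finset.range J then x k else 0 := by
      have h2 : SequenceAlgebra.coord (∑ n ∈ Finset.range J, x n • e n) k
          = ∑ n ∈ Finset.range J, x n * e n k := by
        rw [map_sum, Finset.sum_apply]
        rfl
      refine h2.trans ?_
      simp [he]
    rw [ZeroAtInftyContinuousMap.sub_apply, h1]
    split_ifs with h
    · simpa using (half_pos hr).le
    · rw [zero_sub, norm_neg]
      exact (hJ k (by simpa using h)).le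

end CZero

/-! ### The weights `1 + a / n ^ (1 - α)` -/

section Example

theorem isSigmaCompact_Ioi_zero : IsSigmaCompact (Set.Ioi (0 : ℝ)) := by
  have h : Set.Ioi (0 : ℝ) = ⋃ n : ℕ, Set.Icc (1 / ((n : ℝ) + 1)) n := by
    ext x
    simp only [Set.mem_Ioi, Set.mem_iUnion, Set.mem_Icc]
    constructor
    · intro hx
      obtain ⟨n, hn⟩ := exists_nat_one_div_lt hx
      obtain ⟨m, hm⟩ := exists_nat_ge x
      refine ⟨max n m, le_trans ?_ hn.le, hm.trans (by exact_mod_cast le_max_right n m)⟩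
      gcongr
      exact le_max_left n m
    · rintro ⟨n, hn, -⟩
      exact lt_of_lt_of_le (by positivity) hn
  rw [h]
  exact isSigmaCompact_iUnion_of_isCompact _ fun _ => isCompact_Icc

variable {X : Type*} [NonUnitalNormedCommRing X] [NormedSpace ℂ X] [SequenceAlgebra X]

/-- The affine dependence of the weights on the parameter passes to the shifts, which gives the
joint continuity. -/
theorem isContinuousWeightFamily_one_add_mul
    (hX : ∀ (w : ℕ → ℝ) (C : ℝ), (∀ n, |w n| ≤ C) → ∃ T, IsBackwardShift X w T)
    {v : ℕ → ℝ} {C : ℝ} (hv0 : ∀ n, 0 ≤ v n) (hv : ∀ n, v n ≤ C) :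
    IsContinuousWeightFamily X (Set.Ioi 0) fun a n => 1 + a * v n := by
  obtain ⟨T₁, h₁⟩ := hX (fun _ => 1) 1 (by simp)
  obtain ⟨T₂, h₂⟩ := hX v C fun n => by rw [abs_of_nonneg (hv0 n)]; exact hv n
  have hT (a : ℝ) : IsBackwardShift X (fun n => 1 + a * v n) (T₁ + (a : ℂ) • T₂) := by
    intro x n
    simp only [add_apply, smul_apply, map_add, map_smul,
      Pi.add_apply, Pi.smul_apply, h₁ x n, h₂ x n, smul_eq_mul]
    push_cast
    ring
  have hadm (a : ℝ) (ha : a ∈ Set.Ioi (0 : ℝ)) : IsAdmissible X fun n => 1 + a * v n :=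
    ⟨fun n _ => by have := mul_nonneg (le_of_lt ha) (hv0 n); linarith, _, hT a⟩
  refine ⟨hadm, fun n _ => by fun_prop, ?_⟩
  have hcont : Continuous fun q : ℝ × X => T₁ q.2 + (q.1 : ℂ) • T₂ q.2 := by fun_prop
  refine hcont.continuousOn.congr fun q hq => SequenceAlgebra.coord_injective (funext fun n => ?_)
  rw [coord_backwardShift (hadm q.1 hq.1)]
  exact (hT q.1 q.2 n).symm

theorem abs_log_one_add_mul_sub_le {t a b : ℝ} (ht : 0 ≤ t) (ha : 0 < a) (hb : 0 < b) :
    |Real.log (1 + a * t) - Real.log (1 + b * t)| ≤ t * |a - b| := by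
  wlog hab : b ≤ a generalizing a b
  · rw [abs_sub_comm, abs_sub_comm a]
    exact this hb ha (le_of_not_ge hab)
  have h1 : 0 < 1 + b * t := by positivity
  have h2 : 1 + b * t ≤ 1 + a * t := by gcongr
  rw [abs_of_nonneg (sub_nonneg.2 (Real.log_le_log h1 h2)), abs_of_nonneg (sub_nonneg.2 hab),
    ← Real.log_div (by positivity) h1.ne']
  refine (Real.log_le_sub_one_of_pos (by positivity)).trans ?_
  rw [div_sub_one h1.ne', div_le_iff₀ h1]
  have : 0 ≤ t * (a - b) * (b * t) := by
    have := sub_nonneg.2 hab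
    positivity
  nlinarith

theorem sum_one_div_rpow_le {α : ℝ} (hα₀ : 0 < α) (hα₁ : α ≤ 1) (n : ℕ) :
    ∑ i ∈ Finset.Icc 1 n, 1 / (i : ℝ) ^ (1 - α) ≤ α⁻¹ * (n : ℝ) ^ α := by
  induction n with
  | zero => simp [Real.zero_rpow hα₀.ne']
  | succ n ih =>
    rw [Finset.sum_Icc_succ_top (by omega)]
    have hn : (0 : ℝ) < ((n + 1 : ℕ) : ℝ) := by positivity
    set y : ℝ := ((n + 1 : ℕ) : ℝ) with hy
    have hy1 : 1 ≤ y := by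
      rw [hy]
      push_cast
      linarith [Nat.cast_nonneg (α := ℝ) n]
    have h1 : (1 + -(1 / y)) ^ α ≤ 1 + α * -(1 / y) := by
      refine rpow_one_add_le_one_add_mul_self ?_ hα₀.le hα₁
      have : 1 / y ≤ 1 := (div_le_one hn).2 hy1
      linarith
    have h2 : (n : ℝ) = y * (1 + -(1 / y)) := by
      rw [mul_add, mul_neg, mul_one_div_cancel hn.ne', hy]
      push_cast
      ring
    have h3 : (n : ℝ) ^ α ≤ y ^ α * (1 + α * -(1 / y)) := by
      rw [h2, Real.mul_rpow hn.le]
      · gcongr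
      · have : 1 / y ≤ 1 := (div_le_one hn).2 hy1
        linarith
    have h4 : 1 / y ^ (1 - α) = y ^ α * (1 / y) := by
      rw [Real.rpow_sub hn, Real.rpow_one]
      field_simp
    have h5 : α⁻¹ * (n : ℝ) ^ α ≤ α⁻¹ * (y ^ α * (1 + α * -(1 / y))) := by gcongr
    have h6 : α⁻¹ * (y ^ α * (1 + α * -(1 / y))) = α⁻¹ * y ^ α - y ^ α * (1 / y) := by
      field_simp
      ring
    rw [h4]
    linarith

theorem rpow_le_sum_one_div_rpow {α : ℝ} (hα₀ : 0 < α) (hα₁ : α ≤ 1) (n : ℕ) :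
    (n : ℝ) ^ α ≤ ∑ i ∈ Finset.Icc 1 n, 1 / (i : ℝ) ^ (1 - α) := by
  rcases Nat.eq_zero_or_pos n with rfl | hn
  · simp [Real.zero_rpow hα₀.ne']
  · have hn0 : (0 : ℝ) < n := by exact_mod_cast hn
    have h1 : (n : ℝ) ^ α = (Finset.Icc 1 n).card • (1 / (n : ℝ) ^ (1 - α)) := by
      rw [Nat.card_Icc, Nat.add_sub_cancel, nsmul_eq_mul, Real.rpow_sub hn0, Real.rpow_one]
      field_simp
    rw [h1]
    refine Finset.card_nsmul_le_sum _ _ _ fun i hi => ?_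
    obtain ⟨hi1, hin⟩ := Finset.mem_Icc.1 hi
    have hi0 : (0 : ℝ) < i := by exact_mod_cast hi1
    have : 0 ≤ 1 - α := by linarith
    gcongr

theorem powerGrowthCondition_one_add_div_rpow {α : ℝ} (hα₀ : 0 < α) (hα₁ : α ≤ 1) :
    PowerGrowthCondition α (Set.Ioi 0) fun a n => 1 + a / (n : ℝ) ^ (1 - α) := by
  intro I₀ hI₀ hc
  obtain ⟨A₁, hA₁, h₁⟩ : ∃ A₁ > (0 : ℝ), ∀ a ∈ I₀, A₁ ≤ a := by
    rcases I₀.eq_empty_or_nonempty with rfl | hne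
    · exact ⟨1, one_pos, by simp⟩
    · obtain ⟨m, hm, hm'⟩ := hc.exists_isLeast hne
      exact ⟨m, hI₀ hm, hm'⟩
  obtain ⟨A₂, h₂⟩ := hc.bddAbove
  have hα : 0 ≤ 1 - α := by linarith
  refine ⟨α⁻¹, by positivity, 1, one_pos, A₁ / (1 + |A₂|), by positivity, 0, fun n _ =>
    ⟨fun a ha b hb => ?_, fun a ha => ?_⟩⟩
  · rw [← Finset.sum_sub_distrib]
    refine (Finset.abs_sum_le_sum_abs _ _).trans ?_
    calc ∑ i ∈ Finset.Icc 1 n, |Real.log (1 + a / (i : ℝ) ^ (1 - α))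
          - Real.log (1 + b / (i : ℝ) ^ (1 - α))|
        ≤ ∑ i ∈ Finset.Icc 1 n, 1 / (i : ℝ) ^ (1 - α) * |a - b| := by
          refine Finset.sum_le_sum fun i _ => ?_
          rw [← mul_one_div a, ← mul_one_div b]
          exact abs_log_one_add_mul_sub_le (by positivity) (hI₀ ha) (hI₀ hb)
      _ = (∑ i ∈ Finset.Icc 1 n, 1 / (i : ℝ) ^ (1 - α)) * |a - b| := by rw [Finset.sum_mul]
      _ ≤ α⁻¹ * (n : ℝ) ^ α * |a - b| := by
          have := sum_one_div_rpow_le hα₀ hα₁ n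
          gcongr
  · have ha0 : 0 < a := hI₀ ha
    have haA : a ≤ |A₂| := (h₂ ha).trans (le_abs_self _)
    rw [one_mul]
    calc Real.exp (A₁ / (1 + |A₂|) * (n : ℝ) ^ α)
        ≤ Real.exp (∑ i ∈ Finset.Icc 1 n, A₁ / (1 + |A₂|) * (1 / (i : ℝ) ^ (1 - α))) := by
          rw [← Finset.mul_sum]
          have := rpow_le_sum_one_div_rpow hα₀ hα₁ n
          gcongr
      _ = ∏ i ∈ Finset.Icc 1 n, Real.exp (A₁ / (1 + |A₂|) * (1 / (i : ℝ) ^ (1 - α))) :=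
          Real.exp_sum _ _
      _ ≤ ∏ i ∈ Finset.Icc 1 n, (1 + a / (i : ℝ) ^ (1 - α)) := by
          refine Finset.prod_le_prod (fun i _ => (Real.exp_pos _).le) fun i hi => ?_
          have hi1 : (1 : ℝ) ≤ i := by exact_mod_cast (Finset.mem_Icc.1 hi).1
          have hi0 : (1 : ℝ) ≤ (i : ℝ) ^ (1 - α) := Real.one_le_rpow hi1 hα
          set t : ℝ := 1 / (i : ℝ) ^ (1 - α) with ht
          have ht0 : 0 < t := by positivity
          have ht1 : t ≤ 1 := (div_le_one (by positivity)).2 hi0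
          rw [← mul_one_div a, ← ht]
          have hpos : 0 < 1 + a * t := by positivity
          refine (Real.le_log_iff_exp_le hpos).1 (le_trans ?_ (Real.one_sub_inv_le_log_of_pos hpos))
          have e : 1 - (1 + a * t)⁻¹ = a * t / (1 + a * t) := by field_simp; ring
          rw [e, div_mul_eq_mul_div]
          have h3 := h₁ a ha
          have h4 : a * t ≤ |A₂| := by nlinarith
          gcongr

theorem hasCommonHypercyclicAlgebra_one_add_div_rpow [CompleteSpace X] {e : ℕ → X}
    (he : IsUnitVectorSystem e)
    (hX : ∀ (w : ℕ → ℝ) (C : ℝ), (∀ n, |w n| ≤ C) → ∃ T, IsBackwardShift X w T)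
    {d : ℕ} (hd : 1 ≤ d) {α : ℝ} (hα₀ : 0 < α) (hα₁ : α < 1 / (d : ℝ)) :
    HasCommonHypercyclicAlgebra {l : Fin d → ℝ | ∀ i, 0 < l i}
      (productShift X fun a n => 1 + a / (n : ℝ) ^ (1 - α)) := by
  have hα : α < 1 := hα₁.trans_le ((div_le_one (by positivity)).2 (by exact_mod_cast hd))
  have hw : IsContinuousWeightFamily X (Set.Ioi 0) fun a n => 1 + a / (n : ℝ) ^ (1 - α) := by
    have h : (fun (a : ℝ) (n : ℕ) => 1 + a / (n : ℝ) ^ (1 - α))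
        = fun (a : ℝ) (n : ℕ) => 1 + a * (1 / (n : ℝ) ^ (1 - α)) := by
      funext a n
      rw [mul_one_div]
    rw [h]
    refine isContinuousWeightFamily_one_add_mul hX (C := 1) (fun n => by positivity) fun n => ?_
    -- The value at `n = 0` is `1 / 0 = 0`.
    rcases Nat.eq_zero_or_pos n with rfl | hn
    · simp [Real.zero_rpow (by linarith : 1 - α ≠ 0)]
    · have h1 : (1 : ℝ) ≤ (n : ℝ) ^ (1 - α) :=
        Real.one_le_rpow (by exact_mod_cast hn) (by linarith)
      exact (div_le_one (by positivity)).2 h1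
  exact hasCommonHypercyclicAlgebra_productShift he hd hα₀ hα₁ isSigmaCompact_Ioi_zero hw
    (powerGrowthCondition_one_add_div_rpow hα₀ hα.le)

end Example

theorem mainTheorem4 (d : ℕ) (hd : 1 ≤ d) (α : ℝ) (hα₀ : 0 < α) (hα₁ : α < 1 / (d : ℝ)) :
    (∀ (p : ℝ≥0∞) [Fact (1 ≤ p)], p ≠ ∞ →
      (∀ (I : Set ℝ) (w : ℝ → ℕ → ℝ), I ⊆ Set.Ioi 0 → IsSigmaCompact I →
        IsContinuousWeightFamily (lp (fun _ : ℕ => ℂ) p) I w → PowerGrowthCondition α I w →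
        HasCommonHypercyclicAlgebra {l : Fin d → ℝ | ∀ i, l i ∈ I}
          (productShift (lp (fun _ : ℕ => ℂ) p) w)) ∧
      HasCommonHypercyclicAlgebra {l : Fin d → ℝ | ∀ i, 0 < l i}
        (productShift (lp (fun _ : ℕ => ℂ) p) fun a n => 1 + a / (n : ℝ) ^ (1 - α))) ∧
    ((∀ (I : Set ℝ) (w : ℝ → ℕ → ℝ), I ⊆ Set.Ioi 0 → IsSigmaCompact I →
        IsContinuousWeightFamily C₀(ℕ, ℂ) I w → PowerGrowthCondition α I w →
        HasCommonHypercyclicAlgebra {l : Fin d → ℝ | ∀ i, l i ∈ I}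
          (productShift C₀(ℕ, ℂ) w)) ∧
      HasCommonHypercyclicAlgebra {l : Fin d → ℝ | ∀ i, 0 < l i}
        (productShift C₀(ℕ, ℂ) fun a n => 1 + a / (n : ℝ) ^ (1 - α))) := by

  refine ⟨fun p _ hp => ?_, ?_⟩
  · let _ := ellpNonUnitalNormedCommRing p hp
    exact ⟨fun I w _ hI hw hg => hasCommonHypercyclicAlgebra_productShift
      (ellp_isUnitVectorSystem hp) hd hα₀ hα₁ hI hw hg,
      hasCommonHypercyclicAlgebra_one_add_div_rpow (ellp_isUnitVectorSystem hp)
        (fun w C hw => ellp_exists_isBackwardShift hp w hw) hd hα₀ hα₁⟩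
  · obtain ⟨e, he⟩ := cZero_exists_isUnitVectorSystem
    exact ⟨fun I w _ hI hw hg => hasCommonHypercyclicAlgebra_productShift he hd hα₀ hα₁ hI hw hg,
      hasCommonHypercyclicAlgebra_one_add_div_rpow he
        (fun w C hw => cZero_exists_isBackwardShift w hw) hd hα₀ hα₁⟩
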